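/- Let $n\ge 1$, let $\Omega\subset\mathbb R^n$ be an open set, and let $\gamma:\mathbb R^n\to\mathbb R$ be measurable with $0<\underline\gamma\le\gamma(x)\le\overline\gamma<\infty$ for a.e. $x\in\mathbb R^n$, for some constants $\underline\gamma,\overline\gamma$. Put $m:=\gamma^{1/2}-1$ and assume that $m\in W^{2,\,n/(2s_0)}_c(\Omega)$ for some $s_0\in(0,1)$ with $2s_0<n$, where for $1<p<\infty$ the set $W^{2,p}_c(\Omega)$ consists of the elements of $W^{2,p}(\mathbb R^n)$ that can be approximated in the Sobolev norm by functions of $C^\infty_c(\Omega)$. For $s\in(0,1)$ let $\mathcal C_{n,s}=\frac{4^s\,\Gamma(n/2+s)}{\pi^{n/2}|\Gamma(-s)|}$, let $$\nabla^s u(x,y)=-\frac{\mathcal C_{n,s}^{1/2}}{\sqrt2}\,\frac{u(y)-u(x)}{|y-x|^{n/2+s+1}}\,(y-x)$$ be the fractional gradient, let the fractional divergence $(\nabla\cdot)^s$ be given by $\langle(\nabla\cdot)^s v,\varphi\rangle=\langle v,\nabla^s\varphi\rangle_{L^2(\mathbb R^{2n})}$ (bilinear pairing) for $v\in L^2(\mathbb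 R^{2n};\mathbb C^n)$, let $\Theta(x,y)=\gamma(x)^{1/2}\gamma(y)^{1/2}\,\mathrm{Id}$, and let $\mathrm C^s_\gamma u=(\nabla\cdot)^s(\Theta\cdot\nabla^s u)$ be the non-local conductivity operator (a non-negative operator, equal to $(-\Delta)^s$ when $\gamma\equiv1$). Then, for every (real- or complex-valued) $u\in H^2(\mathbb R^n)$, one has $\Theta\cdot\nabla^s u\in L^2(\mathbb R^{2n})$ and $\nabla^s\varphi\in L^2(\mathbb R^{2n})$ for all $s\in(0,1)$ and $\varphi\in C^\infty_c(\mathbb R^n)$, so that $\mathrm C^s_\gamma u$ is well defined; the weak gradient $\nabla u$ exists and lies in $L^2(\mathbb R^n)$; and $$\lim_{s\to1^-}\mathrm C^s_\gamma u=-\nabla\cdot(\gamma\nabla u)$$ in the sense of distributions, that is, $$\lim_{s\to1^-}\langle\Theta\cdot\nabla^s u,\nabla^s\varphi\rangle_{L^2(\mathbb R^{2n})}=\int_{\mathbb R^n}\gamma\,\nabla u\cdot\nabla\varphi\,dx\qquad\text{for all }\varphi\in C^\infty_c(\mathbb R^n).$$ -/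

import Mathlib

open MeasureTheory TemperedDistribution Filter Topology
open scoped ENNReal SchwartzMap Distributions

noncomputable section

namespace FracCond

/-- Euclidean space `ℝⁿ`. -/
abbrev Rn (n : ℕ) : Type := EuclideanSpace ℝ (Fin n)

/-- Vectors of `ℂⁿ`, the values of gradients of complex-valued functions on `ℝⁿ`. -/
abbrev Cn (n : ℕ) : Type := EuclideanSpace ℂ (Fin n)

/-- The norm of `f` in the `Lᵖ`-based Sobolev (Bessel potential) space `W^{k,p}(ℝⁿ)`, `k ≥ 0`, that
is the `Lᵖ` norm of the Bessel potential of order `k` of `f`; it is `∞` when `f` is not in `Lᵖ` or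
the Bessel potential of `f` is not (given by) an `Lᵖ` function. -/
def sobolevENorm {n : ℕ} (k : ℝ) (p : ℝ≥0∞) [Fact (1 ≤ p)] (f : Rn n → ℂ) : ℝ≥0∞ :=
  ⨅ (hf : MemLp f p volume) (g : Lp ℂ p (volume : Measure (Rn n)))
    (_ : besselPotential (Rn n) ℂ k (hf.toLp f : 𝓢'(Rn n, ℂ)) = (g : 𝓢'(Rn n, ℂ))), ‖g‖ₑ

/-- `f ∈ W^{k,p}(ℝⁿ)` for `k ≥ 0`. -/
def MemW {n : ℕ} (k : ℝ) (p : ℝ≥0∞) [Fact (1 ≤ p)] (f : Rn n → ℂ) : Prop :=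
  ∃ hf : MemLp f p volume, MemSobolev k p (hf.toLp f : 𝓢'(Rn n, ℂ))

/-- `f ∈ W^{k,p}_c(Ω)`: `f` belongs to `W^{k,p}(ℝⁿ)` and can be approximated in the Sobolev norm by
functions of `C^∞_c(Ω)`. -/
def MemWc {n : ℕ} (Ω : TopologicalSpace.Opens (Rn n)) (k : ℝ) (p : ℝ≥0∞) [Fact (1 ≤ p)]
    (f : Rn n → ℂ) : Prop :=
  MemW k p f ∧
    ∀ ε : ℝ≥0∞, 0 < ε → ∃ φ : 𝓓(Ω, ℂ), sobolevENorm k p (fun x => f x - φ x) < ε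

/-- The constant `C_{n,s} = 4^s Γ(n/2 + s) / (π^{n/2} |Γ(-s)|)`. -/
def fracConst (n : ℕ) (s : ℝ) : ℝ :=
  (4 : ℝ) ^ s * Real.Gamma ((n : ℝ) / 2 + s) /
    (Real.pi ^ ((n : ℝ) / 2) * |Real.Gamma (-s)|)

/-- The fractional gradient
`∇ˢu(x,y) = -(C_{n,s}^{1/2} / √2) (u(y) - u(x)) / |y - x|^{n/2+s+1} (y - x)`
(this pointwise formula also gives, almost everywhere, the continuous extension from `C^∞_c(ℝⁿ)`
to `Hˢ(ℝⁿ)`). -/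
def fracGrad {n : ℕ} (s : ℝ) (u : Rn n → ℂ) (z : Rn n × Rn n) : Cn n :=
  WithLp.toLp 2 fun i =>
    -((Real.sqrt (fracConst n s) / Real.sqrt 2 : ℝ) : ℂ) *
      ((u z.2 - u z.1) / ((‖z.2 - z.1‖ ^ ((n : ℝ) / 2 + s + 1) : ℝ) : ℂ)) *
      ((z.2 i - z.1 i : ℝ) : ℂ)

/-- The fractional divergence of `v : ℝ²ⁿ → ℂⁿ` (square integrable), as the functional
`φ ↦ ⟨v, ∇ˢφ⟩_{L²(ℝ²ⁿ)}`; the pairing is bilinear, as for distributions. -/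
def fracDiv {n : ℕ} (s : ℝ) (v : Rn n × Rn n → Cn n) (φ : Rn n → ℂ) : ℂ :=
  ∫ z : Rn n × Rn n, ∑ i, v z i * fracGrad s φ z i

/-- The interaction matrix `Θ(x,y) = γ(x)^{1/2} γ(y)^{1/2} Id`. -/
def interactionMatrix {n : ℕ} (γ : Rn n → ℝ) (z : Rn n × Rn n) : Matrix (Fin n) (Fin n) ℂ :=
  ((Real.sqrt (γ z.1) * Real.sqrt (γ z.2) : ℝ) : ℂ) • (1 : Matrix (Fin n) (Fin n) ℂ)

/-- The flux `Θ · ∇ˢu`. -/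
def fracFlux {n : ℕ} (s : ℝ) (γ : Rn n → ℝ) (u : Rn n → ℂ) (z : Rn n × Rn n) : Cn n :=
  WithLp.toLp 2 ((interactionMatrix γ z).mulVec (WithLp.ofLp (fracGrad s u z)))

/-- The non-local conductivity operator `C^s_γ u = (∇·)ˢ(Θ · ∇ˢu)`. -/
def fracCond {n : ℕ} (s : ℝ) (γ : Rn n → ℝ) (u : Rn n → ℂ) : (Rn n → ℂ) → ℂ :=
  fracDiv s (fracFlux s γ u)

/-- The partial derivative `∂φ/∂xᵢ`. -/
def partialDeriv {n : ℕ} (i : Fin n) (φ : Rn n → ℂ) (x : Rn n) : ℂ :=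
  fderiv ℝ φ x (EuclideanSpace.single i 1)

/-- `G` is the weak gradient of the locally integrable function `u`. -/
def IsWeakGradient {n : ℕ} (u : Rn n → ℂ) (G : Rn n → Cn n) : Prop :=
  LocallyIntegrable u ∧ LocallyIntegrable G ∧
    ∀ (φ : 𝓓((⊤ : TopologicalSpace.Opens (Rn n)), ℂ)) (i : Fin n),
      ∫ x, u x * partialDeriv i φ x = -∫ x, G x i * φ x

/-- The (local) divergence of a locally integrable vector field `F`, as a distribution:
`⟨∇·F, φ⟩ = -∫ F · ∇φ`. -/
def distDiv {n : ℕ} (F : Rn n → Cn n) (φ : Rn n → ℂ) : ℂ :=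
  -∫ x, ∑ i, F x i * partialDeriv i φ x

end FracCond

end

/-! Substituting `y = x + h` turns the pairing `⟨Θ·∇ˢu, ∇ˢφ⟩` into `∫ k_s(|h|) I(h) dh`. Here
`k_s(r) = C_{n,s}/2 · r^(-n-2s)` is `fracKernel`, and `I(h) = ∫ γ(x)^{1/2} γ(x+h)^{1/2} (u(x+h) -
u(x)) (φ(x+h) - φ(x)) dx` is `incrementForm`. Two facts then give the limit.

Concentration: `C_{n,s}` has a simple zero at `s = 1`, so the mass of `k_s` outside any ball about
`0` tends to `0`, while its second moment over the unit ball tends to `n`. As `k_s` is radial,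
`k_s(|h|) h_i h_j dh` acts like `δ_ij` times the Dirac mass at `0`. Hence `∫ k_s I → ∑ A_ii`
whenever `I` is `O(min(1, |h|²))` and `I(h) = ∑ h_i h_j A_ij + o(|h|²)`
(`tendsto_integral_fracKernel_mul`).

Expansion of `I` (`incrementForm_expansion`): by Plancherel, `u ∈ H²` has an `L²` Taylor expansion
with remainder `O(|h|²)` (`norm_translate_sub_sub_le`), and so has `φ`. Replacing `γ(x+h)^{1/2}` by
`γ(x)^{1/2}` costs `o(|h|²)` by continuity of translations in `L¹` (`tendsto_integral_oscillation`).
Thus `A_ij = ∫ γ ∂_i u ∂_j φ`, whose trace is the claimed limit. -/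

namespace FracCond

noncomputable section

/-! ### Fourier multipliers on `L²` and the second-order Taylor estimate -/

section Fourier

open FourierTransform LineDeriv Real

variable {n : ℕ}

/-- The translation `f ↦ f (· + h)` on `L²`. -/
def translate (h : Rn n) : Lp ℂ 2 (volume : Measure (Rn n)) →+ Lp ℂ 2 (volume : Measure (Rn n)) :=
  Lp.compMeasurePreserving (· + h) (measurePreserving_add_right volume h)

theorem coeFn_translate (h : Rn n) (f : Lp ℂ 2 (volume : Measure (Rn n))) :
    translate h f =ᵐ[volume] fun x => f (x + h) :=
  Lp.coeFn_compMeasurePreserving f _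

/-- The symbol `ξ ↦ exp(2πi⟨ξ, h⟩)` of the translation by `h`. -/
def translateSymbol (h ξ : Rn n) : ℂ := Complex.exp ((2 * π * inner ℝ ξ h : ℝ) * Complex.I)

theorem memLp_translateSymbol (h : Rn n) :
    MemLp (translateSymbol h) ∞ (volume : Measure (Rn n)) := by
  refine memLp_top_of_bound ?_ 1 (ae_of_all _ fun ξ => ?_)
  · have : Continuous (translateSymbol h) := by unfold translateSymbol; fun_prop
    exact this.aestronglyMeasurable
  · rw [translateSymbol, Complex.norm_exp_ofReal_mul_I]

theorem fourier_comp_add_right (f : 𝓢(Rn n, ℂ)) (h ξ : Rn n) :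
    𝓕 (fun x => f (x + h)) ξ = translateSymbol h ξ * 𝓕 (f : Rn n → ℂ) ξ := by
  have := congrFun (VectorFourier.fourierIntegral_comp_add_right Real.fourierChar
    (volume : Measure (Rn n)) (innerₗ (Rn n)) (f : Rn n → ℂ) h) ξ
  simp only [Function.comp_def] at this
  change VectorFourier.fourierIntegral _ _ _ _ _ = _
  rw [this, Circle.smul_def, Real.fourierChar_apply]
  simp [translateSymbol, real_inner_comm]
  rfl

/-- Both sides are continuous in `f` on `L²`, so it is enough to check Schwartz functions, which are
dense. -/
theorem fourier_translate (h : Rn n) (f : Lp ℂ 2 (volume : Measure (Rn n))) :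
    𝓕 (translate h f) = (((memLp_translateSymbol h).toLp _ : Lp ℂ ∞ (volume : Measure (Rn n))) •
      (𝓕 f : Lp ℂ 2 (volume : Measure (Rn n))) : Lp ℂ 2 (volume : Measure (Rn n))) := by
  induction f using DenseRange.induction_on
    (SchwartzMap.denseRange_toLpCLM (F := ℂ) (E := Rn n) (p := 2) (μ := volume)
      ENNReal.ofNat_ne_top) with
  | hp =>
    have hF : Continuous fun f : Lp ℂ 2 (volume : Measure (Rn n)) => 𝓕 f :=
      (fourierCLM ℂ (Lp (α := Rn n) ℂ 2)).continuous
    refine isClosed_eq (hF.comp (Lp.isometry_compMeasurePreserving _).continuous)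
      ((((ContinuousLinearMap.lsmul ℂ ℂ).holderL volume ∞ 2 2
        ((memLp_translateSymbol h).toLp _)).continuous).comp hF)
  | ih f =>
    have h1 : translate h (f.toLp 2) = (f.compSubConstCLM ℂ (-h)).toLp 2 := by
      refine Lp.ext ((coeFn_translate h _).trans ?_)
      have h2 := (measurePreserving_add_right volume h).quasiMeasurePreserving.ae
        (f.coeFn_toLp 2 volume)
      filter_upwards [h2, (f.compSubConstCLM ℂ (-h)).coeFn_toLp 2 volume] with x hx hx'
      rw [hx, hx']; simp
    change 𝓕 (translate h (f.toLp 2)) = ((memLp_translateSymbol h).toLp _ :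
      Lp ℂ ∞ (volume : Measure (Rn n))) • 𝓕 (f.toLp 2)
    rw [h1, SchwartzMap.toLp_fourier_eq, SchwartzMap.toLp_fourier_eq]
    refine Lp.ext ?_
    filter_upwards [(𝓕 (f.compSubConstCLM ℂ (-h))).coeFn_toLp 2 volume,
      (𝓕 f).coeFn_toLp 2 volume, (memLp_translateSymbol h).coeFn_toLp,
      Lp.coeFn_lpSMul (r := 2) ((memLp_translateSymbol h).toLp _) ((𝓕 f).toLp 2 volume)]
      with ξ h2 h3 h4 h5
    have h6 : ⇑(f.compSubConstCLM ℂ (-h)) = fun x => f (x + h) := by ext x; simp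
    rw [h2, h5, Pi.smul_apply', h3, h4, smul_eq_mul, SchwartzMap.fourier_coe,
      SchwartzMap.fourier_coe, ← fourier_comp_add_right, h6]

/-- Taylor's bound covers `|t| ≤ 1`; beyond that the triangle inequality gives `2 + |t| ≤ 3 t²`. The
bound must hold for all `t`, since the frequency is unbounded. -/
theorem norm_exp_mul_I_sub_le (t : ℝ) :
    ‖Complex.exp (t * Complex.I) - 1 - t * Complex.I‖ ≤ 3 * t ^ 2 := by
  rcases le_or_gt |t| 1 with ht | ht
  · have h1 : ‖(t : ℂ) * Complex.I‖ = |t| := by simp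
    have := Complex.norm_exp_sub_one_sub_id_le (x := t * Complex.I) (by rw [h1]; exact ht)
    rw [h1, sq_abs] at this
    nlinarith [sq_nonneg t]
  · calc _ ≤ ‖Complex.exp (t * Complex.I)‖ + ‖(1 : ℂ)‖ + ‖(t : ℂ) * Complex.I‖ :=
        (norm_sub_le _ _).trans (by gcongr; exact norm_sub_le _ _)
      _ = 2 + |t| := by rw [Complex.norm_exp_ofReal_mul_I]; simp; norm_num
      _ ≤ 3 * t ^ 2 := by rw [← sq_abs]; nlinarith

theorem toTemperedDistribution_injective {p : ℝ≥0∞} [Fact (1 ≤ p)]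
    {f g : Lp ℂ p (volume : Measure (Rn n))} (h : (f : 𝓢'(Rn n, ℂ)) = (g : 𝓢'(Rn n, ℂ))) :
    f = g :=
  LinearMap.ker_eq_bot.1 (Lp.ker_toTemperedDistributionCLM_eq_bot (F := ℂ) (μ := volume) (p := p)) h

/-- The symbol `ξ ↦ (1 + |ξ|²)⁻¹` of the Bessel potential of order `-2`. -/
def besselSymbol (ξ : Rn n) : ℂ := ((1 + ‖ξ‖ ^ 2) ^ (-1 : ℝ) : ℝ)

theorem hasTemperateGrowth_besselSymbol :
    (besselSymbol : Rn n → ℂ).HasTemperateGrowth := by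
  unfold besselSymbol; fun_prop

theorem memLp_top_of_hasTemperateGrowth {σ : Rn n → ℂ} (hσ : σ.HasTemperateGrowth) {C : ℝ}
    (hC : ∀ ξ, ‖σ ξ‖ ≤ C) : MemLp σ ∞ (volume : Measure (Rn n)) :=
  memLp_top_of_bound hσ.1.continuous.aestronglyMeasurable C (ae_of_all _ hC)

/-- On `L²`, a bounded Fourier multiplier is multiplication of the Fourier transform. -/
theorem fourier_ae_eq_of_eq_smul {f g : Lp ℂ 2 (volume : Measure (Rn n))} {σ : Rn n → ℂ}
    (hσ : σ.HasTemperateGrowth) {C : ℝ} (hC : ∀ ξ, ‖σ ξ‖ ≤ C)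
    (h : 𝓕 (f : 𝓢'(Rn n, ℂ)) = smulLeftCLM ℂ σ (𝓕 (g : 𝓢'(Rn n, ℂ)))) :
    (𝓕 f : Lp ℂ 2 (volume : Measure (Rn n))) =ᵐ[volume]
      fun ξ => σ ξ * (𝓕 g : Lp ℂ 2 (volume : Measure (Rn n))) ξ := by
  have hm := memLp_top_of_hasTemperateGrowth hσ hC
  rw [Lp.fourier_toTemperedDistribution_eq, Lp.fourier_toTemperedDistribution_eq,
    ← Lp.toTemperedDistribution_smul_eq (r := 2) hσ hm] at h
  rw [toTemperedDistribution_injective h]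
  filter_upwards [hm.coeFn_toLp, Lp.coeFn_lpSMul (r := 2) (hm.toLp _)
    (𝓕 g : Lp ℂ 2 (volume : Measure (Rn n)))] with ξ h1 h2
  rw [h2, Pi.smul_apply', h1, smul_eq_mul]

theorem fourier_eq_besselSymbol_smul {u g : Lp ℂ 2 (volume : Measure (Rn n))}
    (h : besselPotential (Rn n) ℂ 2 (u : 𝓢'(Rn n, ℂ)) = (g : 𝓢'(Rn n, ℂ))) :
    𝓕 (u : 𝓢'(Rn n, ℂ)) = smulLeftCLM ℂ besselSymbol (𝓕 (g : 𝓢'(Rn n, ℂ))) := by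
  rw [← besselPotential_neg_apply_eq_iff] at h
  rw [← h, fourier_besselPotential_eq_smulLeftCLM_fourier_apply]
  congr 2
  ext ξ
  simp [besselSymbol]

theorem norm_besselSymbol (ξ : Rn n) : ‖besselSymbol ξ‖ = (1 + ‖ξ‖ ^ 2)⁻¹ := by
  rw [besselSymbol, Real.rpow_neg_one, Complex.norm_real, Real.norm_of_nonneg (by positivity)]

theorem norm_besselSymbol_le (ξ : Rn n) : ‖besselSymbol ξ‖ ≤ 1 := by
  rw [norm_besselSymbol]
  exact inv_le_one_of_one_le₀ (by nlinarith [sq_nonneg ‖ξ‖])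

/-- The two derivatives of `H²`: this factor absorbs the `|ξ|²` in the remainder of the exponential.
-/
theorem norm_mul_besselSymbol_le (ξ : Rn n) : ‖ξ‖ ^ 2 * ‖besselSymbol ξ‖ ≤ 1 := by
  rw [norm_besselSymbol, mul_inv_le_iff₀ (by positivity)]
  linarith

/-- The derivative is expressed through `𝓕 g` rather than `𝓕 u`, so that its multiplier is bounded
and `u`, its translates and its derivatives are all compared through one `L²` function. -/
theorem fourier_lineDeriv_ae_eq {u g G : Lp ℂ 2 (volume : Measure (Rn n))} {e : Rn n}
    (h : besselPotential (Rn n) ℂ 2 (u : 𝓢'(Rn n, ℂ)) = (g : 𝓢'(Rn n, ℂ)))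
    (hG : (G : 𝓢'(Rn n, ℂ)) = ∂_{e} (u : 𝓢'(Rn n, ℂ))) :
    (𝓕 G : Lp ℂ 2 (volume : Measure (Rn n))) =ᵐ[volume] fun ξ =>
      (2 * π * Complex.I * (inner ℝ ξ e : ℝ) * besselSymbol ξ) *
        (𝓕 g : Lp ℂ 2 (volume : Measure (Rn n))) ξ := by
  have hi : (fun ξ : Rn n => 2 * π * Complex.I * ((inner ℝ ξ e : ℝ) : ℂ)).HasTemperateGrowth := by
    fun_prop
  have hi' : (fun ξ : Rn n => ((inner ℝ ξ e : ℝ) : ℂ)).HasTemperateGrowth := by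
    fun_prop
  refine fourier_ae_eq_of_eq_smul (C := 2 * π * ‖e‖)
    (σ := fun ξ => 2 * π * Complex.I * (inner ℝ ξ e : ℝ) * besselSymbol ξ)
    (hi.mul hasTemperateGrowth_besselSymbol) (fun ξ => ?_) ?_
  · have h1 := abs_real_inner_le_norm ξ e
    -- From `‖ξ‖ ≤ (1 + ‖ξ‖²) / 2`.
    have h2 : ‖ξ‖ * ‖besselSymbol ξ‖ ≤ 1 := by
      nlinarith [norm_besselSymbol_le ξ, norm_mul_besselSymbol_le ξ, norm_nonneg ξ,
        norm_nonneg (besselSymbol ξ), sq_nonneg (‖ξ‖ - 1)]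
    simp only [norm_mul, Complex.norm_I, Complex.norm_real, Complex.norm_ofNat, Real.norm_eq_abs,
      abs_of_pos Real.pi_pos, mul_one]
    calc _ ≤ 2 * π * (‖ξ‖ * ‖e‖) * ‖besselSymbol ξ‖ := by gcongr
      _ = 2 * π * ‖e‖ * (‖ξ‖ * ‖besselSymbol ξ‖) := by ring
      _ ≤ 2 * π * ‖e‖ * 1 := by gcongr
      _ = _ := mul_one _
  · rw [hG, TemperedDistribution.fourier_lineDerivOp_eq, fourier_eq_besselSymbol_smul h,
      smulLeftCLM_smulLeftCLM_apply hasTemperateGrowth_besselSymbol hi',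
      ← smul_apply, ← smulLeftCLM_smul (hasTemperateGrowth_besselSymbol.mul hi')]
    congr 2
    ext ξ
    simp only [Pi.smul_apply, Pi.mul_apply, smul_eq_mul]
    ring

/-- By Plancherel: with `τ = 2π⟨ξ, t⟩`, the transform of the remainder is `(exp(iτ) - 1 - iτ)(1 +
|ξ|²)⁻¹ 𝓕 g`, and `3τ² (1 + |ξ|²)⁻¹ ≤ 12π²|t|²`. -/
theorem norm_translate_sub_sub_le {u g : Lp ℂ 2 (volume : Measure (Rn n))}
    {G : Fin n → Lp ℂ 2 (volume : Measure (Rn n))}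
    (h : besselPotential (Rn n) ℂ 2 (u : 𝓢'(Rn n, ℂ)) = (g : 𝓢'(Rn n, ℂ)))
    (hG : ∀ i, (G i : 𝓢'(Rn n, ℂ)) = ∂_{EuclideanSpace.single i (1 : ℝ)} (u : 𝓢'(Rn n, ℂ)))
    (t : Rn n) :
    ‖translate t u - u - ∑ i, ((t i : ℝ) : ℂ) • G i‖ ≤ (12 * π ^ 2 * ‖t‖ ^ 2) * ‖g‖ := by
  rw [← Lp.norm_fourier_eq, ← Lp.norm_fourier_eq g]
  have hF : 𝓕 (translate t u - u - ∑ i, ((t i : ℝ) : ℂ) • G i) =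
      𝓕 (translate t u) - 𝓕 u - ∑ i, ((t i : ℝ) : ℂ) • 𝓕 (G i) := by
    change Lp.fourierTransformₗᵢ (Rn n) ℂ _ = Lp.fourierTransformₗᵢ (Rn n) ℂ _ -
      Lp.fourierTransformₗᵢ (Rn n) ℂ _ - ∑ i, _ • Lp.fourierTransformₗᵢ (Rn n) ℂ _
    simp only [map_sub, map_sum, map_smul]
  rw [hF]
  refine Lp.norm_le_mul_norm_of_ae_le_mul ?_
  have hs : (∑ i, ((t i : ℝ) : ℂ) • 𝓕 (G i) : Lp ℂ 2 (volume : Measure (Rn n))) =ᵐ[volume]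
      fun ξ => ∑ i, ((t i : ℝ) : ℂ) * (𝓕 (G i) : Lp ℂ 2 (volume : Measure (Rn n))) ξ := by
    refine (Lp.coeFn_fun_finsetSum _ _).trans ?_
    have : ∀ i, (((t i : ℝ) : ℂ) • 𝓕 (G i) : Lp ℂ 2 (volume : Measure (Rn n))) =ᵐ[volume]
        ((t i : ℝ) : ℂ) • (𝓕 (G i) : Lp ℂ 2 (volume : Measure (Rn n))) :=
      fun i => Lp.coeFn_smul _ _
    filter_upwards [ae_all_iff.2 this] with ξ hξ
    simp only [hξ, Pi.smul_apply, smul_eq_mul]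
  have hu := fourier_ae_eq_of_eq_smul hasTemperateGrowth_besselSymbol norm_besselSymbol_le
    (fourier_eq_besselSymbol_smul h)
  have ht : (𝓕 (translate t u) : Lp ℂ 2 (volume : Measure (Rn n))) =ᵐ[volume] fun ξ =>
      translateSymbol t ξ * (𝓕 u : Lp ℂ 2 (volume : Measure (Rn n))) ξ := by
    rw [fourier_translate]
    filter_upwards [(memLp_translateSymbol t).coeFn_toLp,
      Lp.coeFn_lpSMul (r := 2) ((memLp_translateSymbol t).toLp _)
        (𝓕 u : Lp ℂ 2 (volume : Measure (Rn n)))] with ξ h1 h2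
    rw [h2, Pi.smul_apply', h1, smul_eq_mul]
  filter_upwards [hs, hu, ht, ae_all_iff.2 fun i => fourier_lineDeriv_ae_eq h (hG i),
    Lp.coeFn_sub (𝓕 (translate t u) - 𝓕 u) (∑ i, ((t i : ℝ) : ℂ) • 𝓕 (G i)),
    Lp.coeFn_sub (𝓕 (translate t u)) (𝓕 u)] with ξ h1 h2 h3 h4 h5 h6
  rw [h5, Pi.sub_apply, h6, Pi.sub_apply, h1, h3, h2]
  simp only [h4]
  have hin : (inner ℝ ξ t : ℝ) = ∑ i, t i * inner ℝ ξ (EuclideanSpace.single i (1 : ℝ)) := by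
    simp [PiLp.inner_apply]
  have hsum : ∑ i, ((t i : ℝ) : ℂ) * (2 * π * Complex.I *
      (inner ℝ ξ (EuclideanSpace.single i (1 : ℝ)) : ℝ) * besselSymbol ξ *
        (𝓕 g : Lp ℂ 2 (volume : Measure (Rn n))) ξ) =
      (2 * π * inner ℝ ξ t : ℝ) * Complex.I * besselSymbol ξ *
        (𝓕 g : Lp ℂ 2 (volume : Measure (Rn n))) ξ := by
    rw [hin]
    push_cast
    simp only [Finset.mul_sum, Finset.sum_mul]
    refine Finset.sum_congr rfl fun i _ => ?_
    ring
  rw [hsum, show ∀ a b c d : ℂ, a * (b * d) - b * d - c * b * d = (a - 1 - c) * b * d by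
    intros; ring, norm_mul, norm_mul]
  refine mul_le_mul_of_nonneg_right ?_ (norm_nonneg _)
  have h7 := norm_exp_mul_I_sub_le (2 * π * inner ℝ ξ t)
  have h8 : (inner ℝ ξ t : ℝ) ^ 2 ≤ (‖ξ‖ * ‖t‖) ^ 2 :=
    sq_le_sq' (neg_le_of_abs_le (abs_real_inner_le_norm ξ t)) (real_inner_le_norm ξ t)
  calc _ ≤ 3 * (2 * π * inner ℝ ξ t) ^ 2 * ‖besselSymbol ξ‖ := by
        gcongr; exact h7
    _ = 12 * π ^ 2 * (inner ℝ ξ t) ^ 2 * ‖besselSymbol ξ‖ := by ring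
    _ ≤ 12 * π ^ 2 * (‖ξ‖ * ‖t‖) ^ 2 * ‖besselSymbol ξ‖ := by gcongr
    _ = 12 * π ^ 2 * ‖t‖ ^ 2 * (‖ξ‖ ^ 2 * ‖besselSymbol ξ‖) := by ring
    _ ≤ 12 * π ^ 2 * ‖t‖ ^ 2 * 1 := by gcongr; exact norm_mul_besselSymbol_le ξ
    _ = _ := mul_one _

end Fourier

/-! ### First-order expansions in `L²` for `H²` functions and test functions -/

section Expansion

open FourierTransform LineDeriv Real

variable {n : ℕ}

/-- `u` and `G` are square integrable and `u(· + h) = u + h · G + O(|h|²)` in `L²(ℝⁿ)`. -/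
structure HasL2Expansion (u : Rn n → ℂ) (G : Rn n → Cn n) : Prop where
  memLp : MemLp u 2 volume
  memLp_grad : MemLp G 2 volume
  bound : ∃ C : ℝ, 0 ≤ C ∧ ∀ h : Rn n,
    eLpNorm (fun x => u (x + h) - u x - ∑ i, ((h i : ℝ) : ℂ) * G x i) 2 volume ≤
      ENNReal.ofReal (C * ‖h‖ ^ 2)

theorem hasL2Expansion_of_lineDeriv {u : Rn n → ℂ} {G : Rn n → Cn n} (hu : MemLp u 2 volume)
    (hG : ∀ i, MemLp (fun x => G x i) 2 volume)
    (hB : MemSobolev 2 2 (hu.toLp u : 𝓢'(Rn n, ℂ)))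
    (hd : ∀ i, ((hG i).toLp _ : 𝓢'(Rn n, ℂ)) =
      ∂_{EuclideanSpace.single i (1 : ℝ)} (hu.toLp u : 𝓢'(Rn n, ℂ))) :
    HasL2Expansion u G := by
  obtain ⟨g, hg⟩ := hB
  refine ⟨hu, memLp_piLp_iff.2 hG, 12 * π ^ 2 * ‖g‖, by positivity, fun h => ?_⟩
  have h1 := norm_translate_sub_sub_le hg hd h
  rw [Lp.norm_def, show 12 * π ^ 2 * ‖h‖ ^ 2 * ‖g‖ = 12 * π ^ 2 * ‖g‖ * ‖h‖ ^ 2 by ring] at h1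
  rw [← ENNReal.le_ofReal_iff_toReal_le (Lp.memLp _).2.ne (by positivity)] at h1
  refine le_trans (le_of_eq (eLpNorm_congr_ae ?_)) h1
  have hs : (∑ i, ((h i : ℝ) : ℂ) • (hG i).toLp _ : Lp ℂ 2 (volume : Measure (Rn n))) =ᵐ[volume]
      fun x => ∑ i, ((h i : ℝ) : ℂ) * G x i := by
    refine (Lp.coeFn_fun_finsetSum _ _).trans ?_
    have h2 : ∀ i, (((h i : ℝ) : ℂ) • (hG i).toLp _ : Lp ℂ 2 (volume : Measure (Rn n))) =ᵐ[volume]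
        ((h i : ℝ) : ℂ) • fun x => G x i :=
      fun i => (Lp.coeFn_smul _ _).trans ((hG i).coeFn_toLp.const_smul _)
    filter_upwards [ae_all_iff.2 h2] with x hx
    simp only [hx, Pi.smul_apply, smul_eq_mul]
  filter_upwards [hs, coeFn_translate h (hu.toLp u), hu.coeFn_toLp,
    (measurePreserving_add_right volume h).quasiMeasurePreserving.ae hu.coeFn_toLp,
    Lp.coeFn_sub (translate h (hu.toLp u) - hu.toLp u) (∑ i, ((h i : ℝ) : ℂ) • (hG i).toLp _),
    Lp.coeFn_sub (translate h (hu.toLp u)) (hu.toLp u)] with x h1 h2 h3 h4 h5 h6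
  rw [h5, Pi.sub_apply, h6, Pi.sub_apply, h1, h2, h3, h4]

theorem exists_hasL2Expansion {u : Rn n → ℂ} (hu : MemW 2 2 u) :
    ∃ G : Rn n → Cn n, HasL2Expansion u G ∧ IsWeakGradient u G := by
  obtain ⟨hu, hB⟩ := hu
  have h1 : ∀ i, ∃ Gi : Lp ℂ 2 (volume : Measure (Rn n)), (Gi : 𝓢'(Rn n, ℂ)) =
      ∂_{EuclideanSpace.single i (1 : ℝ)} (hu.toLp u : 𝓢'(Rn n, ℂ)) := fun i => by
    -- A derivative costs one order of smoothness, so it stays in `H¹` and in particular in `L²`.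
    obtain ⟨Gi, hGi⟩ := memSobolev_zero_iff.1
      ((hB.lineDerivOp (m := EuclideanSpace.single i (1 : ℝ))).mono (s' := 0) (by norm_num))
    exact ⟨Gi, hGi.symm⟩
  choose Gi hGi using h1
  have hG : ∀ i, MemLp (fun x => (WithLp.toLp 2 fun i => Gi i x : Cn n) i) 2 volume :=
    fun i => Lp.memLp (Gi i)
  have hL : HasL2Expansion u (fun x => WithLp.toLp 2 fun i => Gi i x) := by
    refine hasL2Expansion_of_lineDeriv hu hG hB fun i => ?_
    rw [← hGi i]
    congr 1
    exact Lp.toLp_coeFn _ _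
  refine ⟨_, hL, hu.locallyIntegrable (by norm_num),
    hL.memLp_grad.locallyIntegrable (by norm_num), fun φ i => ?_⟩
  -- The distributional derivative is tested against `φ` seen as a Schwartz function, which is the
  -- definition of the weak gradient.
  let ψ : 𝓢(Rn n, ℂ) := φ.hasCompactSupport.toSchwartzMap φ.contDiff
  have h2 := congrArg (fun T : 𝓢'(Rn n, ℂ) => T ψ) (hGi i)
  simp only [TemperedDistribution.lineDerivOp_apply_apply, Lp.toTemperedDistribution_apply,
    smul_eq_mul] at h2
  have hd : ∀ x, (-∂_{EuclideanSpace.single i (1 : ℝ)} ψ : 𝓢(Rn n, ℂ)) x = -partialDeriv i φ x := by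
    intro x
    rw [neg_apply, SchwartzMap.lineDerivOp_apply_eq_fderiv]
    rfl
  have h3 : ∫ x, -(u x * partialDeriv i φ x) = ∫ x, Gi i x * φ x := by
    refine Eq.trans (integral_congr_ae ?_) (h2.symm.trans
      (integral_congr_ae (ae_of_all _ fun x => mul_comm _ _)))
    filter_upwards [hu.coeFn_toLp] with x hx
    rw [hx, hd, neg_mul, mul_comm]
  rw [integral_neg] at h3
  exact neg_eq_iff_eq_neg.1 h3

theorem hasL2Expansion_testFunction (φ : 𝓓((⊤ : TopologicalSpace.Opens (Rn n)), ℂ)) :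
    HasL2Expansion φ (fun x => WithLp.toLp 2 fun i => partialDeriv i φ x) := by
  let ψ : 𝓢(Rn n, ℂ) := φ.hasCompactSupport.toSchwartzMap φ.contDiff
  have hd : ∀ i, ⇑(∂_{EuclideanSpace.single i (1 : ℝ)} ψ : 𝓢(Rn n, ℂ)) = partialDeriv i φ := by
    intro i
    ext x
    rw [SchwartzMap.lineDerivOp_apply_eq_fderiv]
    rfl
  have hG : ∀ i, MemLp (fun x => (WithLp.toLp 2 fun i => partialDeriv i φ x : Cn n) i) 2 volume :=
    fun i => by
      have := (∂_{EuclideanSpace.single i (1 : ℝ)} ψ : 𝓢(Rn n, ℂ)).memLp 2 volume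
      rwa [hd i] at this
  have hψ : (ψ.memLp 2 volume).toLp φ = ψ.toLp 2 := rfl
  refine hasL2Expansion_of_lineDeriv (ψ.memLp 2 volume) hG ?_ fun i => ?_
  · rw [hψ, Lp.toTemperedDistribution_toLp_eq]
    exact ψ.memSobolev
  · rw [hψ, Lp.toTemperedDistribution_toLp_eq, lineDerivOp_toTemperedDistributionCLM_eq,
      ← Lp.toTemperedDistribution_toLp_eq (p := 2)]
    congr 1

end Expansion

/-! ### Moments of radial kernels, integrals of powers, and the constant `C_{n,s}` -/

section Moments

open Real Set

variable {n : ℕ}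

/-- The reflection `h_i ↦ -h_i` preserves volume and norm and changes the sign of the integrand. -/
theorem integral_norm_mul_coord_mul_coord_eq_zero (k : ℝ → ℝ) {i j : Fin n} (hij : i ≠ j) :
    ∫ h : Rn n, k ‖h‖ * (h i * h j) = 0 := by
  let e : Rn n ≃ₗᵢ[ℝ] Rn n := LinearIsometryEquiv.piLpCongrRight 2
    fun l => if l = i then LinearIsometryEquiv.neg ℝ else LinearIsometryEquiv.refl ℝ ℝ
  have h1 := e.measurePreserving.integral_comp e.toHomeomorph.measurableEmbedding
    fun h : Rn n => k ‖h‖ * (h i * h j)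
  have h2 : ∀ h : Rn n, k ‖e h‖ * (e h i * e h j) = -(k ‖h‖ * (h i * h j)) := by
    intro h
    have hi : e h i = -h i := by simp [e]
    have hj : e h j = h j := by simp [e, hij.symm]
    rw [e.norm_map, hi, hj]
    ring
  simp only [h2, integral_neg] at h1
  linarith

theorem integral_norm_mul_coord_sq_eq (k : ℝ → ℝ) (i j : Fin n) :
    ∫ h : Rn n, k ‖h‖ * h i ^ 2 = ∫ h : Rn n, k ‖h‖ * h j ^ 2 := by
  let e : Rn n ≃ₗᵢ[ℝ] Rn n := LinearIsometryEquiv.piLpCongrLeft 2 ℝ ℝ (Equiv.swap i j)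
  have h1 := e.measurePreserving.integral_comp e.toHomeomorph.measurableEmbedding
    fun h : Rn n => k ‖h‖ * h j ^ 2
  rw [← h1]
  congr 1
  ext h
  have hi : e h j = h i := by
    simp [e, LinearIsometryEquiv.piLpCongrLeft_apply, Equiv.piCongrLeft']
  rw [e.norm_map, hi]

/-- Permuting coordinates shows that the `n` integrals agree, and they add up to the integral of `k
|h|²`. -/
theorem integral_norm_mul_coord_sq (k : ℝ → ℝ)
    (hk : Integrable fun h : Rn n => k ‖h‖ * ‖h‖ ^ 2) (i : Fin n) :
    ∫ h : Rn n, k ‖h‖ * h i ^ 2 = (∫ h : Rn n, k ‖h‖ * ‖h‖ ^ 2) / n := by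
  have hn : (n : ℝ) ≠ 0 := by have := i.pos; positivity
  have hint : ∀ j, Integrable fun h : Rn n => k ‖h‖ * h j ^ 2 := by
    intro j
    -- Integrability is inherited from `hk` through the bounded factor `h_j² / |h|²`; at `h = 0` the
    -- convention `0 / 0 = 0` is harmless.
    have hb : ∀ h : Rn n, ‖h j ^ 2 / ‖h‖ ^ 2‖ ≤ 1 := fun h => by
      rw [norm_of_nonneg (by positivity)]
      refine div_le_one_of_le₀ ?_ (by positivity)
      rw [← sq_abs]
      gcongr
      exact PiLp.norm_apply_le h j
    refine (hk.mul_bdd (c := 1) (g := fun h : Rn n => h j ^ 2 / ‖h‖ ^ 2)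
      (Measurable.aestronglyMeasurable (by fun_prop)) (ae_of_all _ hb)).congr (ae_of_all _ fun h => ?_)
    rcases eq_or_ne h 0 with rfl | hh
    · simp
    · have : ‖h‖ ≠ 0 := norm_ne_zero_iff.2 hh
      simp only
      field_simp
  have h1 : ∫ h : Rn n, k ‖h‖ * ‖h‖ ^ 2 = ∑ j, ∫ h : Rn n, k ‖h‖ * h j ^ 2 := by
    rw [← integral_finsetSum _ fun j _ => hint j]
    congr 1
    ext h
    rw [EuclideanSpace.real_norm_sq_eq, Finset.mul_sum]
  rw [h1, Finset.sum_congr rfl fun j _ => integral_norm_mul_coord_sq_eq k j i]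
  field_simp
  simp [mul_comm]

theorem measureReal_ball_one (hn : n ≠ 0) :
    (volume : Measure (Rn n)).real (Metric.ball 0 1) = π ^ ((n : ℝ) / 2) / Gamma (n / 2 + 1) := by
  have : Nonempty (Fin n) := ⟨⟨0, Nat.pos_of_ne_zero hn⟩⟩
  rw [Measure.real, EuclideanSpace.volume_ball]
  simp only [ENNReal.ofReal_one, one_pow, one_mul, Fintype.card_fin]
  rw [ENNReal.toReal_ofReal (by positivity), Real.sqrt_eq_rpow, ← Real.rpow_mul_natCast pi_nonneg]
  congr 2
  ring

theorem nontrivial_Rn (hn : n ≠ 0) : Nontrivial (Rn n) := by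
  have : Nonempty (Fin n) := ⟨⟨0, Nat.pos_of_ne_zero hn⟩⟩
  infer_instance

theorem pow_pred_smul_rpow (hn : n ≠ 0) {y : ℝ} (hy : 0 < y) (a : ℝ) :
    y ^ (Module.finrank ℝ (Rn n) - 1) • y ^ a = y ^ ((n : ℝ) - 1 + a) := by
  rw [finrank_euclideanSpace_fin, smul_eq_mul, ← Real.rpow_natCast, ← Real.rpow_add hy,
    Nat.cast_sub (Nat.one_le_iff_ne_zero.2 hn), Nat.cast_one]

theorem integrableOn_ball_norm_rpow (hn : n ≠ 0) {a : ℝ} (ha : -n < a) :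
    IntegrableOn (fun h : Rn n => ‖h‖ ^ a) (Metric.ball 0 1) := by
  have := nontrivial_Rn hn
  rw [integrableOn_fun_norm_addHaar (volume : Measure (Rn n)) (f := fun r : ℝ => r ^ a),
    integrableOn_congr_fun (fun y hy => pow_pred_smul_rpow hn hy.1 a) measurableSet_Ioo,
    ← intervalIntegrable_iff_integrableOn_Ioo_of_le zero_le_one]
  exact intervalIntegral.intervalIntegrable_rpow' (by linarith)

/-- Polar coordinates reduce this to `∫₀¹ r^(n-1+a) dr = 1 / (n + a)`; `n |B₁|` is the area of the
unit sphere. -/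
theorem integral_ball_norm_rpow (hn : n ≠ 0) {a : ℝ} (ha : -n < a) :
    ∫ h in Metric.ball (0 : Rn n) 1, ‖h‖ ^ a =
      n * (volume : Measure (Rn n)).real (Metric.ball 0 1) / (n + a) := by
  have := nontrivial_Rn hn
  rw [← integral_indicator Metric.isOpen_ball.measurableSet]
  have h1 := integral_fun_norm_addHaar (volume : Measure (Rn n))
    (indicator (Iio 1) fun r : ℝ => r ^ a)
  have h2 : ∀ y ∈ Ioi (0 : ℝ), y ^ (Module.finrank ℝ (Rn n) - 1) •
      indicator (Iio 1) (fun r : ℝ => r ^ a) y =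
      indicator (Ioo 0 1) (fun r : ℝ => r ^ ((n : ℝ) - 1 + a)) y := by
    intro y hy
    by_cases hy1 : y < 1
    · rw [indicator_of_mem (mem_Iio.2 hy1), indicator_of_mem (mem_Ioo.2 ⟨hy, hy1⟩),
        pow_pred_smul_rpow hn hy]
    · rw [indicator_of_notMem (s := Iio 1) hy1, indicator_of_notMem (s := Ioo 0 1) fun h => hy1 h.2,
        smul_zero]
  rw [setIntegral_congr_fun measurableSet_Ioi h2, setIntegral_indicator measurableSet_Ioo,
    inter_eq_right.2 Ioo_subset_Ioi_self, ← integral_Ioc_eq_integral_Ioo,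
    ← intervalIntegral.integral_of_le zero_le_one, integral_rpow (Or.inl (by linarith)),
    finrank_euclideanSpace_fin, Real.one_rpow, Real.zero_rpow (by linarith)] at h1
  have h3 : ∀ h : Rn n, indicator (Metric.ball (0 : Rn n) 1) (fun h => ‖h‖ ^ a) h =
      indicator (Iio 1) (fun r : ℝ => r ^ a) ‖h‖ := by
    intro h
    simp [indicator]
  simp only [h3]
  rw [h1, nsmul_eq_mul, smul_eq_mul]
  ring

theorem integrableOn_compl_ball_norm_rpow (hn : n ≠ 0) {a δ : ℝ} (ha : a < -n) (hδ : 0 < δ) :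
    IntegrableOn (fun h : Rn n => ‖h‖ ^ a) (Metric.ball 0 δ)ᶜ := by
  have := nontrivial_Rn hn
  have h3 : indicator (Metric.ball (0 : Rn n) δ)ᶜ (fun h => ‖h‖ ^ a) =
      fun h => indicator (Ici δ) (fun r : ℝ => r ^ a) ‖h‖ := by
    ext h
    simp [indicator]
  rw [← integrable_indicator_iff Metric.isOpen_ball.measurableSet.compl, h3,
    integrable_fun_norm_addHaar]
  have h2 : ∀ y ∈ Ioi (0 : ℝ), y ^ (Module.finrank ℝ (Rn n) - 1) •
      indicator (Ici δ) (fun r : ℝ => r ^ a) y =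
      indicator (Ici δ) (fun r : ℝ => r ^ ((n : ℝ) - 1 + a)) y := by
    intro y hy
    by_cases hy1 : δ ≤ y
    · rw [indicator_of_mem (mem_Ici.2 hy1), indicator_of_mem (mem_Ici.2 hy1),
        pow_pred_smul_rpow hn hy]
    · rw [indicator_of_notMem (s := Ici δ) hy1, indicator_of_notMem (s := Ici δ) hy1, smul_zero]
  rw [integrableOn_congr_fun h2 measurableSet_Ioi]
  refine ((integrable_indicator_iff measurableSet_Ici).2 ?_).integrableOn
  rw [integrableOn_Ici_iff_integrableOn_Ioi]
  exact integrableOn_Ioi_rpow_of_lt (by linarith) hδ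

theorem integral_compl_ball_norm_rpow (hn : n ≠ 0) {a δ : ℝ} (ha : a < -n) (hδ : 0 < δ) :
    ∫ h in (Metric.ball (0 : Rn n) δ)ᶜ, ‖h‖ ^ a =
      n * (volume : Measure (Rn n)).real (Metric.ball 0 1) * (-δ ^ (n + a) / (n + a)) := by
  have := nontrivial_Rn hn
  have h3 : indicator (Metric.ball (0 : Rn n) δ)ᶜ (fun h => ‖h‖ ^ a) =
      fun h => indicator (Ici δ) (fun r : ℝ => r ^ a) ‖h‖ := by
    ext h
    simp [indicator]
  rw [← integral_indicator Metric.isOpen_ball.measurableSet.compl, h3,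
    integral_fun_norm_addHaar]
  have h2 : ∀ y ∈ Ioi (0 : ℝ), y ^ (Module.finrank ℝ (Rn n) - 1) •
      indicator (Ici δ) (fun r : ℝ => r ^ a) y =
      indicator (Ici δ) (fun r : ℝ => r ^ ((n : ℝ) - 1 + a)) y := by
    intro y hy
    by_cases hy1 : δ ≤ y
    · rw [indicator_of_mem (mem_Ici.2 hy1), indicator_of_mem (mem_Ici.2 hy1),
        pow_pred_smul_rpow hn hy]
    · rw [indicator_of_notMem (s := Ici δ) hy1, indicator_of_notMem (s := Ici δ) hy1, smul_zero]
  rw [setIntegral_congr_fun measurableSet_Ioi h2, setIntegral_indicator measurableSet_Ici,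
    inter_eq_right.2 (Ici_subset_Ioi.2 hδ), integral_Ici_eq_integral_Ioi,
    integral_Ioi_rpow_of_lt (by linarith) hδ, finrank_euclideanSpace_fin,
    nsmul_eq_mul, smul_eq_mul, show (n : ℝ) - 1 + a + 1 = n + a by ring]
  ring

/-- The factor `w` in `C_{n,s} = (1 - s) w(s)`. -/
def fracConstFactor (n : ℕ) (s : ℝ) : ℝ :=
  (4 : ℝ) ^ s * Gamma ((n : ℝ) / 2 + s) * s / (π ^ ((n : ℝ) / 2) * Gamma (2 - s))

/-- Two uses of `Γ(z+1) = zΓ(z)` give `|Γ(-s)| = Γ(2-s) / ((1-s)s)`. The pole of `Γ` at `-1` thus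
becomes the explicit factor `1 - s`, and what remains is continuous at `s = 1`. -/
theorem fracConst_eq {s : ℝ} (hs : s ∈ Ioo (0 : ℝ) 1) :
    fracConst n s = (1 - s) * fracConstFactor n s := by
  have h1 : Gamma (2 - s) = (1 - s) * (-s * Gamma (-s)) := by
    rw [← Real.Gamma_add_one (by linarith [hs.1]), show -s + 1 = 1 - s by ring,
      ← Real.Gamma_add_one (by linarith [hs.2])]
    congr 1; ring
  have h2 : 0 < Gamma (2 - s) := Gamma_pos_of_pos (by linarith [hs.2])
  have hs1 : 0 < 1 - s := by linarith [hs.2]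
  have h3 : |Gamma (-s)| = Gamma (2 - s) / ((1 - s) * s) := by
    have h4 : Gamma (-s) = -(Gamma (2 - s) / ((1 - s) * s)) := by
      rw [h1]
      have := hs.1.ne'
      field_simp
    rw [h4, abs_neg, abs_of_nonneg]
    have := hs.1
    positivity
  rw [fracConst, fracConstFactor, h3]
  have := hs.1.ne'
  field_simp

theorem fracConst_nonneg {s : ℝ} (hs : 0 < s) : 0 ≤ fracConst n s := by
  rw [fracConst]
  have : 0 < Gamma ((n : ℝ) / 2 + s) := Gamma_pos_of_pos (by positivity)
  positivity

theorem tendsto_fracConstFactor :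
    Tendsto (fracConstFactor n) (𝓝[<] 1) (𝓝 (4 * Gamma ((n : ℝ) / 2 + 1) / π ^ ((n : ℝ) / 2))) := by
  have h1 : ContinuousAt (fracConstFactor n) 1 := by
    unfold fracConstFactor
    have hG : ContinuousAt (fun s : ℝ => Gamma ((n : ℝ) / 2 + s)) 1 := by
      refine ContinuousAt.comp (g := Gamma) ?_ (by fun_prop)
      exact (differentiableAt_Gamma fun m => by
        have : (0 : ℝ) ≤ m := m.cast_nonneg
        have : (0 : ℝ) ≤ n := n.cast_nonneg
        linarith).continuousAt
    have hG' : ContinuousAt (fun s : ℝ => Gamma (2 - s)) 1 := by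
      refine ContinuousAt.comp (g := Gamma) ?_ (by fun_prop)
      exact (differentiableAt_Gamma fun m => by
        have : (0 : ℝ) ≤ m := m.cast_nonneg
        linarith).continuousAt
    have h4 : ContinuousAt (fun s : ℝ => (4 : ℝ) ^ s) 1 :=
      (Real.continuous_const_rpow (by norm_num)).continuousAt
    refine ContinuousAt.div ((h4.mul hG).mul continuousAt_id) (continuousAt_const.mul hG') ?_
    norm_num
    positivity
  have h2 := h1.tendsto.mono_left (nhdsWithin_le_nhds (s := Iio 1))
  convert h2 using 2
  norm_num [fracConstFactor]

/-- The kernel `C_{n,s} / 2 |h|^{-n-2s}` of `(-Δ)ˢ`. -/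
def fracKernel (n : ℕ) (s r : ℝ) : ℝ := fracConst n s / 2 * r ^ (-(n : ℝ) - 2 * s)

end Moments

/-! ### Concentration of the kernel at the origin as `s → 1` -/

section Kernel

open Real Set

variable {n : ℕ}

theorem fracKernel_nonneg {s r : ℝ} (hs : 0 < s) (hr : 0 ≤ r) : 0 ≤ fracKernel n s r := by
  have := fracConst_nonneg (n := n) hs
  rw [fracKernel]
  positivity

theorem measurable_fracKernel (s : ℝ) : Measurable (fracKernel n s) := by
  unfold fracKernel
  fun_prop

/-- The origin has to be discarded: adding exponents of `r` can fail at `r = 0`, where `0 ^ 0 = 1`.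
-/
theorem ae_ne_zero (hn : n ≠ 0) : ∀ᵐ h : Rn n, h ≠ 0 := by
  have := nontrivial_Rn hn
  exact compl_mem_ae_iff.2 (measure_singleton 0)

theorem fracKernel_mul_sq (s : ℝ) {r : ℝ} (hr : 0 < r) :
    fracKernel n s r * r ^ 2 = fracConst n s / 2 * r ^ (2 - (n : ℝ) - 2 * s) := by
  rw [fracKernel, mul_assoc, ← Real.rpow_natCast, ← Real.rpow_add hr]
  congr 2
  push_cast
  ring

theorem integrableOn_ball_fracKernel_mul_sq (hn : n ≠ 0) {s : ℝ} (hs : s < 1) :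
    IntegrableOn (fun h : Rn n => fracKernel n s ‖h‖ * ‖h‖ ^ 2) (Metric.ball 0 1) := by
  refine ((integrableOn_ball_norm_rpow hn (a := 2 - n - 2 * s) (by linarith)).const_mul
    (fracConst n s / 2)).congr (ae_restrict_of_ae ?_)
  filter_upwards [ae_ne_zero hn] with h hh
  rw [fracKernel_mul_sq s (norm_pos_iff.2 hh)]

/-- The radial integral contributes `1 / (2(1-s))`, which cancels the factor `1 - s` of the constant
exactly. -/
theorem integral_ball_fracKernel_mul_sq (hn : n ≠ 0) {s : ℝ} (hs : s ∈ Ioo (0 : ℝ) 1) :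
    ∫ h in Metric.ball (0 : Rn n) 1, fracKernel n s ‖h‖ * ‖h‖ ^ 2 =
      fracConstFactor n s * n * (volume : Measure (Rn n)).real (Metric.ball 0 1) / 4 := by
  have h1 : ∫ h in Metric.ball (0 : Rn n) 1, fracKernel n s ‖h‖ * ‖h‖ ^ 2 =
      ∫ h in Metric.ball (0 : Rn n) 1, fracConst n s / 2 * ‖h‖ ^ (2 - (n : ℝ) - 2 * s) := by
    refine integral_congr_ae (ae_restrict_of_ae ?_)
    filter_upwards [ae_ne_zero hn] with h hh
    rw [fracKernel_mul_sq s (norm_pos_iff.2 hh)]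
  have h2 : 1 - s ≠ 0 := by linarith [hs.2]
  rw [h1, integral_const_mul, integral_ball_norm_rpow hn (by linarith [hs.2]), fracConst_eq hs,
    show (n : ℝ) + (2 - n - 2 * s) = 2 * (1 - s) by ring]
  field_simp
  ring

/-- The limit of `fracConstFactor` is `4 / |B₁|`, so the normalisation of `C_{n,s}` leaves exactly
`n`. -/
theorem tendsto_integral_ball_fracKernel_mul_sq (hn : n ≠ 0) :
    Tendsto (fun s => ∫ h in Metric.ball (0 : Rn n) 1, fracKernel n s ‖h‖ * ‖h‖ ^ 2)
      (𝓝[<] 1) (𝓝 n) := by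
  have h1 : ∀ᶠ s : ℝ in 𝓝[<] 1, s ∈ Ioo (0 : ℝ) 1 := Ioo_mem_nhdsLT one_pos
  have h2 := ((tendsto_fracConstFactor (n := n)).mul_const (n : ℝ)).mul_const
    ((volume : Measure (Rn n)).real (Metric.ball 0 1)) |>.div_const 4
  refine Tendsto.congr' (h1.mono fun s hs => (integral_ball_fracKernel_mul_sq hn hs).symm) ?_
  convert h2 using 2
  rw [measureReal_ball_one hn]
  have : Gamma ((n : ℝ) / 2 + 1) ≠ 0 := (Gamma_pos_of_pos (by positivity)).ne'
  have : π ^ ((n : ℝ) / 2) ≠ 0 := by positivity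
  field_simp

theorem integrableOn_compl_ball_fracKernel (hn : n ≠ 0) {s δ : ℝ} (hs : 0 < s) (hδ : 0 < δ) :
    IntegrableOn (fun h : Rn n => fracKernel n s ‖h‖) (Metric.ball 0 δ)ᶜ :=
  (integrableOn_compl_ball_norm_rpow hn (by linarith) hδ).const_mul _

/-- Away from the origin the radial integral `δ^(-2s) / (2s)` stays bounded, so the factor `1 - s`
wins. -/
theorem tendsto_integral_compl_ball_fracKernel (hn : n ≠ 0) {δ : ℝ} (hδ : 0 < δ) :
    Tendsto (fun s => ∫ h in (Metric.ball (0 : Rn n) δ)ᶜ, fracKernel n s ‖h‖)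
      (𝓝[<] 1) (𝓝 0) := by
  have h1 : ∀ᶠ s : ℝ in 𝓝[<] 1, s ∈ Ioo (0 : ℝ) 1 := Ioo_mem_nhdsLT one_pos
  have h2 : ∀ s ∈ Ioo (0 : ℝ) 1, (1 - s) * fracConstFactor n s / 2 *
      (n * (volume : Measure (Rn n)).real (Metric.ball 0 1) * (-δ ^ (-2 * s) / (-2 * s))) =
      ∫ h in (Metric.ball (0 : Rn n) δ)ᶜ, fracKernel n s ‖h‖ := by
    intro s hs
    simp only [fracKernel]
    rw [integral_const_mul, integral_compl_ball_norm_rpow hn (by linarith [hs.1]) hδ,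
      fracConst_eq hs, show (n : ℝ) + (-n - 2 * s) = -2 * s by ring]
  refine Tendsto.congr' (h1.mono h2) ?_
  have h3 : Tendsto (fun s : ℝ => 1 - s) (𝓝[<] 1) (𝓝 0) := by
    have : Tendsto (fun s : ℝ => 1 - s) (𝓝 1) (𝓝 (1 - 1)) := by
      exact (continuous_const.sub continuous_id).tendsto 1
    rw [sub_self] at this
    exact this.mono_left nhdsWithin_le_nhds
  have h4 : Tendsto (fun s : ℝ => -δ ^ (-2 * s) / (-2 * s)) (𝓝[<] 1)
      (𝓝 (-δ ^ (-2 * (1 : ℝ)) / (-2 * 1))) := by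
    refine Tendsto.mono_left ?_ nhdsWithin_le_nhds
    refine ContinuousAt.tendsto (f := fun s : ℝ => -δ ^ (-2 * s) / (-2 * s)) ?_
    refine ContinuousAt.div (ContinuousAt.neg ?_) (by fun_prop) (by norm_num)
    exact ContinuousAt.rpow (by fun_prop) (by fun_prop) (Or.inl hδ.ne')
  have h5 := ((h3.mul (tendsto_fracConstFactor (n := n))).div_const 2).mul
    (h4.const_mul (n * (volume : Measure (Rn n)).real (Metric.ball 0 1)))
  simpa using h5

theorem integrable_fracKernel_mul_min (hn : n ≠ 0) {s : ℝ} (hs : s ∈ Ioo (0 : ℝ) 1) :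
    Integrable fun h : Rn n => fracKernel n s ‖h‖ * min 1 (‖h‖ ^ 2) := by
  rw [← integrableOn_univ, ← union_compl_self (Metric.ball (0 : Rn n) 1)]
  refine IntegrableOn.union ?_ ?_
  · refine (integrableOn_ball_fracKernel_mul_sq hn hs.2).congr_fun (fun h hh => ?_)
      Metric.isOpen_ball.measurableSet
    have : ‖h‖ < 1 := by simpa using hh
    simp only
    rw [min_eq_right (by nlinarith [norm_nonneg h])]
  · refine (integrableOn_compl_ball_fracKernel hn hs.1 one_pos).congr_fun (fun h hh => ?_)
      Metric.isOpen_ball.measurableSet.compl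
    have : 1 ≤ ‖h‖ := by simpa using hh
    simp only
    rw [min_eq_left (by nlinarith), mul_one]

theorem integrable_fracKernel_mul (hn : n ≠ 0) {s : ℝ} (hs : s ∈ Ioo (0 : ℝ) 1) {R : Rn n → ℂ}
    (hR : AEStronglyMeasurable R volume) {K : ℝ} (hK : ∀ h, ‖R h‖ ≤ K * min 1 (‖h‖ ^ 2)) :
    Integrable fun h : Rn n => (fracKernel n s ‖h‖ : ℂ) * R h := by
  refine ((integrable_fracKernel_mul_min hn hs).const_mul K).mono'
    (AEStronglyMeasurable.mul (Measurable.aestronglyMeasurable ?_) hR) (ae_of_all _ fun h => ?_)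
  · have := measurable_fracKernel (n := n) s
    fun_prop
  · have := fracKernel_nonneg (n := n) hs.1 (norm_nonneg h)
    rw [norm_mul, Complex.norm_real, norm_of_nonneg this]
    nlinarith [hK h]

/-- Near `0` the smallness of `R` is tested against a bounded second moment; elsewhere `R` is
bounded and the mass of the kernel vanishes. -/
theorem tendsto_integral_fracKernel_mul_zero (hn : n ≠ 0) {R : Rn n → ℂ} {K : ℝ}
    (hK : ∀ h, ‖R h‖ ≤ K * min 1 (‖h‖ ^ 2))
    (hsmall : ∀ ε > 0, ∃ δ > 0, ∀ h, ‖h‖ < δ → ‖R h‖ ≤ ε * ‖h‖ ^ 2) :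
    Tendsto (fun s : ℝ => ∫ h : Rn n, (fracKernel n s ‖h‖ : ℂ) * R h) (𝓝[<] 1) (𝓝 0) := by
  rw [Metric.tendsto_nhds]
  intro η hη
  -- The second moment is eventually below `n + 1`, so this choice leaves `η / 2` for the outer
  -- region.
  obtain ⟨δ, hδ, hR'⟩ := hsmall (η / (2 * (n + 1))) (by positivity)
  have e1 : ∀ᶠ s : ℝ in 𝓝[<] 1, s ∈ Ioo (0 : ℝ) 1 := Ioo_mem_nhdsLT one_pos
  have e2 := (tendsto_integral_ball_fracKernel_mul_sq hn).eventually_lt_const (lt_add_one (n : ℝ))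
  have e3 : ∀ᶠ s : ℝ in 𝓝[<] 1,
      |K| * ∫ h in (Metric.ball (0 : Rn n) (min δ 1))ᶜ, fracKernel n s ‖h‖ < η / 2 := by
    have := (tendsto_integral_compl_ball_fracKernel hn (lt_min hδ one_pos)).const_mul |K|
    rw [mul_zero] at this
    exact this.eventually_lt_const (half_pos hη)
  filter_upwards [e1, e2, e3] with s hs h2 h3
  rw [dist_zero_right]
  have i1 := ((integrableOn_ball_fracKernel_mul_sq hn hs.2).integrable_indicator
    Metric.isOpen_ball.measurableSet).const_mul (η / (2 * (n + 1)))
  have i2 := ((integrableOn_compl_ball_fracKernel hn hs.1 (lt_min hδ one_pos)).integrable_indicator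
    Metric.isOpen_ball.measurableSet.compl).const_mul |K|
  have hle := norm_integral_le_of_norm_le (i1.add i2)
    (f := fun h : Rn n => (fracKernel n s ‖h‖ : ℂ) * R h) (ae_of_all _ fun h => ?_)
  · simp only [Pi.add_apply] at hle
    rw [integral_add i1 i2, integral_const_mul, integral_const_mul,
      integral_indicator Metric.isOpen_ball.measurableSet,
      integral_indicator Metric.isOpen_ball.measurableSet.compl] at hle
    refine hle.trans_lt ?_
    have h4 : η / (2 * (n + 1)) * ∫ h in Metric.ball (0 : Rn n) 1, fracKernel n s ‖h‖ * ‖h‖ ^ 2 ≤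
        η / (2 * (n + 1)) * (n + 1) := by gcongr
    have h5 : η / (2 * (n + 1)) * ((n : ℝ) + 1) = η / 2 := by field_simp
    linarith
  · have hκ := fracKernel_nonneg (n := n) hs.1 (norm_nonneg h)
    rw [norm_mul, Complex.norm_real, norm_of_nonneg hκ, Pi.add_apply]
    by_cases hh : ‖h‖ < min δ 1
    · rw [indicator_of_mem (by simpa using hh.trans_le (min_le_right _ _)),
        indicator_of_notMem (by simpa using hh), mul_zero, add_zero]
      nlinarith [hR' h (hh.trans_le (min_le_left _ _))]
    · have h6 : 0 ≤ η / (2 * (n + 1)) *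
          indicator (Metric.ball (0 : Rn n) 1) (fun h => fracKernel n s ‖h‖ * ‖h‖ ^ 2) h :=
        mul_nonneg (by positivity) (indicator_nonneg (fun h _ => mul_nonneg
          (fracKernel_nonneg hs.1 (norm_nonneg h)) (by positivity)) h)
      rw [indicator_of_mem (s := (Metric.ball (0 : Rn n) (min δ 1))ᶜ)
        (by simpa only [mem_compl_iff, Metric.mem_ball, dist_zero_right] using hh)]
      have h7 : ‖R h‖ ≤ |K| := by
        calc _ ≤ K * min 1 (‖h‖ ^ 2) := hK h
          _ ≤ |K| * min 1 (‖h‖ ^ 2) := by gcongr; exact le_abs_self K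
          _ ≤ |K| * 1 := by gcongr; exact min_le_left _ _
          _ = _ := mul_one _
      nlinarith

theorem norm_coord_mul_coord_le (h : Rn n) (i j : Fin n) :
    ‖((h i * h j : ℝ) : ℂ)‖ ≤ ‖h‖ ^ 2 := by
  rw [Complex.norm_real, norm_mul, sq]
  gcongr <;> exact PiLp.norm_apply_le h _

theorem norm_sum_coord_mul_coord_le (A : Fin n → Fin n → ℂ) (h : Rn n) :
    ‖∑ i, ∑ j, ((h i * h j : ℝ) : ℂ) * A i j‖ ≤ (∑ i, ∑ j, ‖A i j‖) * ‖h‖ ^ 2 := by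
  simp only [Finset.sum_mul]
  refine (norm_sum_le _ _).trans (Finset.sum_le_sum fun i _ => (norm_sum_le _ _).trans
    (Finset.sum_le_sum fun j _ => ?_))
  rw [norm_mul, mul_comm]
  gcongr
  exact norm_coord_mul_coord_le h i j

theorem integral_ball_fracKernel_mul_quadratic (hn : n ≠ 0) {s : ℝ} (hs : s ∈ Ioo (0 : ℝ) 1)
    (A : Fin n → Fin n → ℂ) :
    ∫ h : Rn n, (fracKernel n s ‖h‖ : ℂ) * indicator (Metric.ball (0 : Rn n) 1)
      (fun h => ∑ i, ∑ j, ((h i * h j : ℝ) : ℂ) * A i j) h =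
    (((∫ h in Metric.ball (0 : Rn n) 1, fracKernel n s ‖h‖ * ‖h‖ ^ 2) / n : ℝ) : ℂ) *
      ∑ i, A i i := by
  -- Moving the cutoff into the radial profile makes the symmetry lemmas applicable.
  let k : ℝ → ℝ := indicator (Iio 1) (fracKernel n s)
  have hk : ∀ h : Rn n, k ‖h‖ * ‖h‖ ^ 2 =
      indicator (Metric.ball (0 : Rn n) 1) (fun h => fracKernel n s ‖h‖ * ‖h‖ ^ 2) h := by
    intro h
    by_cases hh : ‖h‖ < 1 <;> simp [k, indicator, hh]
  have hki : Integrable fun h : Rn n => k ‖h‖ * ‖h‖ ^ 2 := by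
    simp only [hk]
    exact (integrableOn_ball_fracKernel_mul_sq hn hs.2).integrable_indicator
      Metric.isOpen_ball.measurableSet
  have hM : ∫ h in Metric.ball (0 : Rn n) 1, fracKernel n s ‖h‖ * ‖h‖ ^ 2 =
      ∫ h : Rn n, k ‖h‖ * ‖h‖ ^ 2 := by
    simp only [hk]
    rw [integral_indicator Metric.isOpen_ball.measurableSet]
  have hterm : ∀ h : Rn n, (fracKernel n s ‖h‖ : ℂ) * indicator (Metric.ball (0 : Rn n) 1)
      (fun h => ∑ i, ∑ j, ((h i * h j : ℝ) : ℂ) * A i j) h =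
      ∑ i, ∑ j, ((k ‖h‖ * (h i * h j) : ℝ) : ℂ) * A i j := by
    intro h
    by_cases hh : ‖h‖ < 1
    · simp [k, indicator, hh, Finset.mul_sum, mul_assoc]
    · simp [k, indicator, hh]
  have hint : ∀ i j, Integrable fun h : Rn n => ((k ‖h‖ * (h i * h j) : ℝ) : ℂ) * A i j := by
    intro i j
    have hr : Integrable fun h : Rn n => k ‖h‖ * (h i * h j) := by
      refine hki.mono' (Measurable.aestronglyMeasurable ?_) (ae_of_all _ fun h => ?_)
      · have : Measurable k := (measurable_fracKernel s).indicator measurableSet_Iio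
        fun_prop
      · have h1 := norm_coord_mul_coord_le h i j
        rw [Complex.norm_real] at h1
        have h2 : 0 ≤ k ‖h‖ := by
          by_cases hh : ‖h‖ < 1
          · simpa [k, indicator, hh] using fracKernel_nonneg (n := n) hs.1 (norm_nonneg h)
          · simp [k, hh]
        rw [norm_mul, norm_of_nonneg h2]
        gcongr
    exact hr.ofReal.mul_const _
  simp only [hterm]
  rw [integral_finsetSum _ fun i _ => integrable_finsetSum _ fun j _ => hint i j, Finset.mul_sum]
  refine Finset.sum_congr rfl fun i _ => ?_
  rw [integral_finsetSum _ fun j _ => hint i j, Finset.sum_eq_single i]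
  · rw [integral_mul_const, integral_complex_ofReal, hM, ← integral_norm_mul_coord_sq k hki i]
    simp only [sq]
  · intro j _ hj
    rw [integral_mul_const, integral_complex_ofReal,
      integral_norm_mul_coord_mul_coord_eq_zero k (Ne.symm hj)]
    simp
  · simp

theorem tendsto_integral_fracKernel_mul (hn : n ≠ 0) {I : Rn n → ℂ}
    (hI : AEStronglyMeasurable I volume) {K : ℝ} (hK : ∀ h, ‖I h‖ ≤ K * min 1 (‖h‖ ^ 2))
    (A : Fin n → Fin n → ℂ)
    (hsmall : ∀ ε > 0, ∃ δ > 0, ∀ h : Rn n, ‖h‖ < δ →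
      ‖I h - ∑ i, ∑ j, ((h i * h j : ℝ) : ℂ) * A i j‖ ≤ ε * ‖h‖ ^ 2) :
    Tendsto (fun s : ℝ => ∫ h : Rn n, (fracKernel n s ‖h‖ : ℂ) * I h) (𝓝[<] 1)
      (𝓝 (∑ i, A i i)) := by
  -- The quadratic part is cut off because `k_s(|h|) |h|²` is not integrable at infinity for `s <
  -- 1`. The cutoff does not affect `I - Q` near `0`.
  let Q : Rn n → ℂ := indicator (Metric.ball (0 : Rn n) 1)
    (fun h => ∑ i, ∑ j, ((h i * h j : ℝ) : ℂ) * A i j)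
  have hQm : AEStronglyMeasurable Q volume :=
    (Measurable.aestronglyMeasurable (by fun_prop)).indicator Metric.isOpen_ball.measurableSet
  have hQ : ∀ h, ‖Q h‖ ≤ (∑ i, ∑ j, ‖A i j‖) * min 1 (‖h‖ ^ 2) := by
    intro h
    by_cases hh : ‖h‖ < 1
    · simp only [Q]
      rw [indicator_of_mem (by simpa using hh), min_eq_right (by nlinarith [norm_nonneg h])]
      exact norm_sum_coord_mul_coord_le A h
    · simp only [Q]
      rw [indicator_of_notMem (by simpa using hh), norm_zero]
      positivity
  have hR0 : Tendsto (fun s : ℝ => ∫ h : Rn n, (fracKernel n s ‖h‖ : ℂ) * (I h - Q h))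
      (𝓝[<] 1) (𝓝 0) := by
    refine tendsto_integral_fracKernel_mul_zero hn (K := K + ∑ i, ∑ j, ‖A i j‖) (fun h => ?_)
      fun ε hε => ?_
    · rw [add_mul]
      exact (norm_sub_le _ _).trans (add_le_add (hK h) (hQ h))
    · obtain ⟨δ, hδ, hb⟩ := hsmall ε hε
      refine ⟨min δ 1, lt_min hδ one_pos, fun h hh => ?_⟩
      simp only [Q]
      rw [indicator_of_mem (by simpa using hh.trans_le (min_le_right _ _))]
      exact hb h (hh.trans_le (min_le_left _ _))
  have e1 : ∀ᶠ s : ℝ in 𝓝[<] 1, s ∈ Ioo (0 : ℝ) 1 := Ioo_mem_nhdsLT one_pos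
  have hn' : (n : ℝ) ≠ 0 := by exact_mod_cast hn
  have hM : Tendsto (fun s : ℝ => (((∫ h in Metric.ball (0 : Rn n) 1,
      fracKernel n s ‖h‖ * ‖h‖ ^ 2) / n : ℝ) : ℂ) * ∑ i, A i i) (𝓝[<] 1) (𝓝 (∑ i, A i i)) := by
    have h1 := ((tendsto_integral_ball_fracKernel_mul_sq hn).div_const (n : ℝ)).ofReal
      |>.mul_const (∑ i, A i i)
    rw [div_self hn', Complex.ofReal_one, one_mul] at h1
    exact h1
  have h2 := hR0.add hM
  rw [zero_add] at h2
  refine h2.congr' (e1.mono fun s hs => ?_)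
  rw [← integral_ball_fracKernel_mul_quadratic hn hs, ← integral_add]
  · congr 1
    ext h
    simp only [Q]
    ring
  · exact integrable_fracKernel_mul hn hs (K := K + ∑ i, ∑ j, ‖A i j‖) (hI.sub hQm) fun h => by
      rw [add_mul]
      exact (norm_sub_le _ _).trans (add_le_add (hK h) (hQ h))
  · exact integrable_fracKernel_mul hn hs hQm hQ

end Kernel

/-! ### Square integrability of the fractional gradient and reduction to increments -/

section Gradient

open Real Set

variable {n : ℕ}

theorem aestronglyMeasurable_comp_add_right {u : Rn n → ℂ} (hu : AEStronglyMeasurable u volume)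
    (h : Rn n) : AEStronglyMeasurable (fun x => u (x + h)) volume :=
  hu.comp_measurePreserving (measurePreserving_add_right volume h)

theorem eLpNorm_comp_add_right {u : Rn n → ℂ} (hu : AEStronglyMeasurable u volume) (p : ℝ≥0∞)
    (h : Rn n) : eLpNorm (fun x => u (x + h)) p volume = eLpNorm u p volume :=
  eLpNorm_comp_measurePreserving hu (measurePreserving_add_right volume h)

theorem norm_sum_coord_mul_le (h : Rn n) (v : Cn n) :
    ‖∑ i, ((h i : ℝ) : ℂ) * v i‖ ≤ n * ‖h‖ * ‖v‖ := by
  calc _ ≤ ∑ i : Fin n, ‖h‖ * ‖v‖ := norm_sum_le_of_le _ fun i _ => by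
        rw [norm_mul, Complex.norm_real]
        gcongr
        · exact PiLp.norm_apply_le h i
        · exact PiLp.norm_apply_le v i
    _ = _ := by simp [mul_assoc]

/-- For `|h| ≥ 1` the triangle inequality gives `2‖u‖`; for `|h| < 1` the expansion gives `C|h|² +
n|h|‖G‖`, and `|h|² ≤ |h|`. -/
theorem HasL2Expansion.exists_eLpNorm_sub_le {u : Rn n → ℂ} {G : Rn n → Cn n}
    (hu : HasL2Expansion u G) : ∃ K : ℝ, 0 ≤ K ∧ ∀ h : Rn n,
      eLpNorm (fun x => u (x + h) - u x) 2 volume ≤ ENNReal.ofReal (K * min 1 ‖h‖) := by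
  obtain ⟨C, hC, hb⟩ := hu.bound
  have hum := hu.memLp.1
  obtain ⟨a, ha⟩ : ∃ a : ℝ, a = (eLpNorm u 2 volume).toReal := ⟨_, rfl⟩
  obtain ⟨b, hb'⟩ : ∃ b : ℝ, b = (eLpNorm G 2 volume).toReal := ⟨_, rfl⟩
  have ha0 : 0 ≤ a := ha ▸ ENNReal.toReal_nonneg
  have hb0 : 0 ≤ b := hb' ▸ ENNReal.toReal_nonneg
  have hua : eLpNorm u 2 volume = ENNReal.ofReal a := by rw [ha, ENNReal.ofReal_toReal hu.memLp.2.ne]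
  have hGb : eLpNorm G 2 volume = ENNReal.ofReal b := by
    rw [hb', ENNReal.ofReal_toReal hu.memLp_grad.2.ne]
  refine ⟨2 * a + C + n * b, by positivity, fun h => ?_⟩
  rcases le_or_gt 1 ‖h‖ with hh | hh
  · rw [min_eq_left hh, mul_one]
    calc _ ≤ eLpNorm (fun x => u (x + h)) 2 volume + eLpNorm u 2 volume :=
          eLpNorm_sub_le (aestronglyMeasurable_comp_add_right hum h) hum (by norm_num)
      _ = ENNReal.ofReal (2 * a) := by
          rw [eLpNorm_comp_add_right hum, hua, ← ENNReal.ofReal_add ha0 ha0, two_mul]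
      _ ≤ _ := ENNReal.ofReal_le_ofReal (by nlinarith [mul_nonneg (Nat.cast_nonneg (α := ℝ) n) hb0])
  · rw [min_eq_right hh.le]
    have hGm : AEStronglyMeasurable (fun x => ∑ i, ((h i : ℝ) : ℂ) * G x i) volume := by
      refine Finset.aestronglyMeasurable_fun_sum _ fun i _ => ?_
      exact (memLp_piLp_iff.1 hu.memLp_grad i).1.const_mul _
    have h1 : eLpNorm (fun x => ∑ i, ((h i : ℝ) : ℂ) * G x i) 2 volume ≤
        ENNReal.ofReal (n * ‖h‖ * b) := by
      rw [ENNReal.ofReal_mul (by positivity), ← hGb]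
      exact eLpNorm_le_mul_eLpNorm_of_ae_le_mul (ae_of_all _ fun x => norm_sum_coord_mul_le h (G x)) 2
    have h2 : (fun x => u (x + h) - u x) =
        (fun x => u (x + h) - u x - ∑ i, ((h i : ℝ) : ℂ) * G x i) +
          fun x => ∑ i, ((h i : ℝ) : ℂ) * G x i := by
      ext x; simp
    rw [h2]
    refine (eLpNorm_add_le (((aestronglyMeasurable_comp_add_right hum h).sub hum).sub hGm) hGm
      (by norm_num)).trans ((add_le_add (hb h) h1).trans ?_)
    rw [← ENNReal.ofReal_add (by positivity) (by positivity)]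
    refine ENNReal.ofReal_le_ofReal ?_
    nlinarith [norm_nonneg h, mul_nonneg ha0 (norm_nonneg h), mul_nonneg hC (norm_nonneg h)]

theorem measurePreserving_shear :
    MeasurePreserving (fun z : Rn n × Rn n => (z.1, z.1 + z.2)) volume volume :=
  measurePreserving_prod_add volume volume

theorem sq_eLpNorm_two {α E : Type*} [MeasurableSpace α] [NormedAddCommGroup E] {μ : Measure α}
    (f : α → E) : eLpNorm f 2 μ ^ 2 = ∫⁻ x, ‖f x‖ₑ ^ 2 ∂μ := by
  have := eLpNorm_nnreal_pow_eq_lintegral (f := f) (μ := μ) (p := 2) (by norm_num)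
  simpa using this

/-- The scalar factor of the fractional gradient. -/
def fracGradFactor (n : ℕ) (s r : ℝ) : ℝ :=
  -(√(fracConst n s) / √2) / r ^ ((n : ℝ) / 2 + s + 1)

theorem fracGrad_apply (s : ℝ) (u : Rn n → ℂ) (z : Rn n × Rn n) (i : Fin n) :
    fracGrad s u z i = (fracGradFactor n s ‖z.2 - z.1‖ : ℂ) * (u z.2 - u z.1) *
      (((z.2 - z.1) i : ℝ) : ℂ) := by
  simp only [fracGrad, fracGradFactor, PiLp.sub_apply]
  push_cast
  ring

theorem fracGradFactor_sq_mul {s r : ℝ} (hs : 0 < s) (hr : 0 < r) :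
    fracGradFactor n s r ^ 2 * r ^ 2 = fracKernel n s r := by
  rw [fracGradFactor, fracKernel, div_pow, neg_sq, div_pow, sq_sqrt (fracConst_nonneg hs),
    sq_sqrt (by norm_num), ← Real.rpow_natCast (r ^ _), ← Real.rpow_mul hr.le, div_mul_eq_mul_div,
    mul_div_assoc, ← Real.rpow_natCast r, ← Real.rpow_sub hr]
  congr 2
  ring

theorem sum_fracGrad_mul_fracGrad {s : ℝ} (hs : 0 < s) (u φ : Rn n → ℂ) (z : Rn n × Rn n) :
    ∑ i, fracGrad s u z i * fracGrad s φ z i =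
      (fracKernel n s ‖z.2 - z.1‖ : ℂ) * ((u z.2 - u z.1) * (φ z.2 - φ z.1)) := by
  -- On the diagonal both sides vanish with the difference of `u`, whatever value the singular
  -- factor takes at `0`.
  rcases eq_or_ne z.2 z.1 with h | h
  · simp [fracGrad_apply, h]
  · rw [← fracGradFactor_sq_mul hs (norm_pos_iff.2 (sub_ne_zero.2 h)),
      EuclideanSpace.real_norm_sq_eq]
    push_cast
    simp only [fracGrad_apply, Finset.mul_sum, Finset.sum_mul]
    refine Finset.sum_congr rfl fun i _ => ?_
    ring

theorem norm_fracGrad_sq {s : ℝ} (hs : 0 < s) (u : Rn n → ℂ) (z : Rn n × Rn n) :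
    ‖fracGrad s u z‖ ^ 2 = fracKernel n s ‖z.2 - z.1‖ * ‖u z.2 - u z.1‖ ^ 2 := by
  rw [EuclideanSpace.norm_sq_eq]
  rcases eq_or_ne z.2 z.1 with h | h
  · simp [fracGrad_apply, h]
  · rw [← fracGradFactor_sq_mul hs (norm_pos_iff.2 (sub_ne_zero.2 h)),
      EuclideanSpace.real_norm_sq_eq]
    simp only [fracGrad_apply, Finset.mul_sum, Finset.sum_mul, norm_mul, Complex.norm_real, mul_pow,
      Real.norm_eq_abs, sq_abs]
    refine Finset.sum_congr rfl fun i _ => ?_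
    ring

theorem aestronglyMeasurable_fracGrad (s : ℝ) {u : Rn n → ℂ}
    (hu : AEStronglyMeasurable u volume) :
    AEStronglyMeasurable (fracGrad s u) (volume : Measure (Rn n × Rn n)) := by
  refine (PiLp.continuous_toLp 2 fun _ : Fin n => ℂ).comp_aestronglyMeasurable
    (g := fun v => WithLp.toLp 2 v) (f := fun z => WithLp.ofLp (fracGrad s u z)) ?_
  refine AEMeasurable.aestronglyMeasurable (aemeasurable_pi_iff.2 fun i => ?_)
  simp only [fracGrad_apply]
  have h1 : Measurable fun z : Rn n × Rn n => (fracGradFactor n s ‖z.2 - z.1‖ : ℂ) := by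
    unfold fracGradFactor
    fun_prop
  have h2 : Measurable fun z : Rn n × Rn n => (((z.2 - z.1) i : ℝ) : ℂ) := by fun_prop
  have h3 : AEStronglyMeasurable (fun z : Rn n × Rn n => u z.2 - u z.1) volume :=
    AEStronglyMeasurable.sub hu.comp_snd hu.comp_fst
  exact (h1.aemeasurable.mul h3.aemeasurable).mul h2.aemeasurable

/-- After the shear and Tonelli, the squared norm is `∫ k_s(|h|) ‖u(· + h) - u‖² dh`, which is at
most `K² ∫ k_s(|h|) min(1, |h|²) dh`. -/
theorem memLp_fracGrad (hn : n ≠ 0) {s : ℝ} (hs : s ∈ Ioo (0 : ℝ) 1) {u : Rn n → ℂ}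
    {G : Rn n → Cn n} (hu : HasL2Expansion u G) : MemLp (fracGrad s u) 2 volume := by
  obtain ⟨K, hK, hb⟩ := hu.exists_eLpNorm_sub_le
  have hm := aestronglyMeasurable_fracGrad s hu.memLp.1
  refine ⟨hm, ?_⟩
  rw [← eLpNorm_comp_measurePreserving hm measurePreserving_shear]
  suffices h : eLpNorm (fracGrad s u ∘ fun z : Rn n × Rn n => (z.1, z.1 + z.2)) 2 volume ^ 2 < ∞ by
    simpa using h
  have hm' := hm.comp_measurePreserving measurePreserving_shear
  rw [sq_eLpNorm_two, Measure.volume_eq_prod, lintegral_prod_symm _ (hm'.enorm.pow_const 2)]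
  have h1 : ∀ h x : Rn n, ‖(fracGrad s u ∘ fun z : Rn n × Rn n => (z.1, z.1 + z.2)) (x, h)‖ₑ ^ 2 =
      ENNReal.ofReal (fracKernel n s ‖h‖) * ‖u (x + h) - u x‖ₑ ^ 2 := by
    intro h x
    have := norm_fracGrad_sq hs.1 u (x, x + h)
    simp only [add_sub_cancel_left] at this
    rw [Function.comp_apply, ← ofReal_norm, ← ENNReal.ofReal_pow (norm_nonneg _), this,
      ENNReal.ofReal_mul (fracKernel_nonneg hs.1 (norm_nonneg h)),
      ENNReal.ofReal_pow (norm_nonneg _), ofReal_norm]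
  simp only [h1]
  have h2 : ∀ h : Rn n, ∫⁻ x, ENNReal.ofReal (fracKernel n s ‖h‖) * ‖u (x + h) - u x‖ₑ ^ 2 ≤
      ENNReal.ofReal (K ^ 2 * (fracKernel n s ‖h‖ * min 1 (‖h‖ ^ 2))) := by
    intro h
    rw [lintegral_const_mul' _ _ ENNReal.ofReal_ne_top,
      ← sq_eLpNorm_two (fun x => u (x + h) - u x)]
    calc _ ≤ ENNReal.ofReal (fracKernel n s ‖h‖) * ENNReal.ofReal (K * min 1 ‖h‖) ^ 2 := by
          gcongr; exact hb h
      _ = _ := by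
          rw [← ENNReal.ofReal_pow (by positivity),
            ← ENNReal.ofReal_mul (fracKernel_nonneg hs.1 (norm_nonneg h))]
          congr 1
          rcases le_total 1 ‖h‖ with hh | hh
          · rw [min_eq_left hh, min_eq_left (by nlinarith)]; ring
          · rw [min_eq_right hh, min_eq_right (by nlinarith [norm_nonneg h])]; ring
  refine (lintegral_mono h2).trans_lt ?_
  exact ((integrable_fracKernel_mul_min hn hs).const_mul (K ^ 2)).lintegral_lt_top

theorem fracFlux_apply (s : ℝ) (γ : Rn n → ℝ) (u : Rn n → ℂ) (z : Rn n × Rn n) :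
    fracFlux s γ u z = ((√(γ z.1) * √(γ z.2) : ℝ) : ℂ) • fracGrad s u z := by
  ext i
  simp [fracFlux, interactionMatrix, Matrix.smul_mulVec]

theorem memLp_fracFlux {s : ℝ} {γ : Rn n → ℝ} (hγ : Measurable γ) {Γ : ℝ}
    (hΓ : ∀ᵐ x, γ x ≤ Γ) {u : Rn n → ℂ} (hu : MemLp (fracGrad s u) 2 volume) :
    MemLp (fracFlux s γ u) 2 volume := by
  simp only [funext fun z => fracFlux_apply s γ u z]
  have hm : Measurable fun z : Rn n × Rn n => ((√(γ z.1) * √(γ z.2) : ℝ) : ℂ) := by fun_prop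
  refine hu.of_le_mul (c := √Γ * √Γ) (hm.aestronglyMeasurable.smul hu.1) ?_
  filter_upwards [Measure.quasiMeasurePreserving_fst.ae hΓ,
    Measure.quasiMeasurePreserving_snd.ae hΓ] with z h1 h2
  rw [norm_smul, Complex.norm_real, norm_of_nonneg (by positivity)]
  gcongr

/-- The integrand of the quadratic form of `C^s_γ` at the increment `h`. -/
def incrementForm (γ : Rn n → ℝ) (u φ : Rn n → ℂ) (h : Rn n) : ℂ :=
  ∫ x, ((√(γ x) * √(γ (x + h)) : ℝ) : ℂ) * ((u (x + h) - u x) * (φ (x + h) - φ x))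

theorem aestronglyMeasurable_incrementForm {γ : Rn n → ℝ} (hγ : Measurable γ) {u φ : Rn n → ℂ}
    (hu : AEStronglyMeasurable u volume) (hφ : AEStronglyMeasurable φ volume) :
    AEStronglyMeasurable (incrementForm γ u φ) volume := by
  have h1 : ∀ {f : Rn n → ℂ}, AEStronglyMeasurable f volume →
      AEStronglyMeasurable (fun z : Rn n × Rn n => f (z.1 + z.2) - f z.1) volume := by
    intro f hf
    have h2 : AEStronglyMeasurable (fun z : Rn n × Rn n => f z.2) volume := hf.comp_snd
    -- As `f` is only a.e. strongly measurable, composing it with `(x, h) ↦ x + h` relies on the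
    -- shear preserving measure.
    exact (h2.comp_measurePreserving measurePreserving_shear).sub hf.comp_fst
  have hm : Measurable fun z : Rn n × Rn n => ((√(γ z.1) * √(γ (z.1 + z.2)) : ℝ) : ℂ) := by
    fun_prop
  have h3 := hm.aestronglyMeasurable.mul ((h1 hu).mul (h1 hφ))
  rw [Measure.volume_eq_prod] at h3
  exact h3.prod_swap.integral_prod_right'

/-- Shear and Fubini; the latter is justified because the integrand is a sum of products of `L²`
functions. -/
theorem fracCond_eq_integral {s : ℝ} (hs : 0 < s) {γ : Rn n → ℝ} {u φ : Rn n → ℂ}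
    (hu : MemLp (fracFlux s γ u) 2 volume) (hφ : MemLp (fracGrad s φ) 2 volume) :
    fracCond s γ u φ = ∫ h, (fracKernel n s ‖h‖ : ℂ) * incrementForm γ u φ h := by
  have h1 : Integrable (fun z : Rn n × Rn n => ∑ i, fracFlux s γ u z i * fracGrad s φ z i)
      volume :=
    integrable_finsetSum _ fun i _ =>
      (memLp_piLp_iff.1 hu i).integrable_mul (memLp_piLp_iff.1 hφ i)
  have h2 := measurePreserving_shear.integrable_comp_of_integrable h1
  have h3 := measurePreserving_shear.integral_comp
    (MeasurableEquiv.shearAddRight (Rn n)).measurableEmbedding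
    (fun z : Rn n × Rn n => ∑ i, fracFlux s γ u z i * fracGrad s φ z i)
  simp only [Function.comp_def] at h2
  rw [fracCond, fracDiv, ← h3, Measure.volume_eq_prod, integral_prod_symm _ h2]
  congr 1
  ext h
  rw [incrementForm, ← integral_const_mul]
  congr 1
  ext x
  have := sum_fracGrad_mul_fracGrad hs u φ (x, x + h)
  simp only [add_sub_cancel_left] at this
  simp only [fracFlux_apply, PiLp.smul_apply, smul_eq_mul, mul_assoc]
  simp only [← Finset.mul_sum, this]
  ring

end Gradient

/-! ### Second-order expansion of the increment form -/

section Limit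

open Real Set

variable {n : ℕ}

/-- Cauchy–Schwarz with a bounded weight. -/
theorem norm_integral_mul_mul_le {w f g : Rn n → ℂ} {B F G : ℝ} (hB : 0 ≤ B) (hF : 0 ≤ F)
    (hw : ∀ᵐ x, ‖w x‖ ≤ B) (hfm : AEStronglyMeasurable f volume)
    (hgm : AEStronglyMeasurable g volume) (hf : eLpNorm f 2 volume ≤ ENNReal.ofReal F)
    (hg : eLpNorm g 2 volume ≤ ENNReal.ofReal G) (hG : 0 ≤ G) :
    ‖∫ x, w x * (f x * g x)‖ ≤ B * (F * G) := by
  rw [← ENNReal.ofReal_le_ofReal_iff (by positivity), ofReal_norm]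
  calc _ ≤ ∫⁻ x, ‖w x * (f x * g x)‖ₑ := enorm_integral_le_lintegral_enorm _
    _ = eLpNorm (fun x => w x * (f x * g x)) 1 volume := eLpNorm_one_eq_lintegral_enorm.symm
    _ ≤ ENNReal.ofReal B * eLpNorm (f • g) 1 volume := by
        refine eLpNorm_le_mul_eLpNorm_of_ae_le_mul ?_ 1
        filter_upwards [hw] with x hx
        rw [norm_mul]
        exact mul_le_mul_of_nonneg_right hx (norm_nonneg _)
    _ ≤ ENNReal.ofReal B * (eLpNorm f 2 volume * eLpNorm g 2 volume) := by
        gcongr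
        exact eLpNorm_smul_le_mul_eLpNorm hgm hfm
    _ ≤ ENNReal.ofReal B * (ENNReal.ofReal F * ENNReal.ofReal G) := by gcongr
    _ = _ := by rw [← ENNReal.ofReal_mul hF, ← ENNReal.ofReal_mul hB]

theorem integrable_mul_mul {w f g : Rn n → ℂ} {B : ℝ} (hwm : AEStronglyMeasurable w volume)
    (hw : ∀ᵐ x, ‖w x‖ ≤ B) (hf : MemLp f 2 volume) (hg : MemLp g 2 volume) :
    Integrable fun x => w x * (f x * g x) :=
  (hf.integrable_mul hg).bdd_mul (c := B) hwm hw

/-- Continuity of translations in `L¹(ℝⁿ)`. -/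
theorem tendsto_integral_norm_comp_add_right_sub {f : Rn n → ℝ} (hf : Integrable f) :
    Tendsto (fun h : Rn n => ∫ x, ‖f (x + h) - f x‖) (𝓝 0) (𝓝 0) := by
  have hf1 : MemLp f 1 volume := memLp_one_iff_integrable.2 hf
  -- Translations form a continuous family in the compact-open topology, which is the input for
  -- continuity of composition on `Lᵖ`.
  let g : Rn n → C(Rn n, Rn n) := fun h => ⟨fun x => x + h, by fun_prop⟩
  have hg : Continuous g :=
    (ContinuousMap.mk (fun z : Rn n × Rn n => z.2 + z.1) (by fun_prop)).curry.continuous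
  have hgm : ∀ h, MeasurePreserving (g h) (volume : Measure (Rn n)) volume :=
    fun h => measurePreserving_add_right volume h
  have h1 := (tendsto_const_nhds (x := hf1.toLp f)).compMeasurePreservingLp (hg.tendsto 0)
    hgm (hgm 0) ENNReal.one_ne_top
  rw [tendsto_iff_norm_sub_tendsto_zero] at h1
  refine h1.congr fun h => ?_
  rw [L1.norm_eq_integral_norm]
  refine integral_congr_ae ?_
  filter_upwards [Lp.coeFn_sub (Lp.compMeasurePreserving (g h) (hgm h) (hf1.toLp f))
      (Lp.compMeasurePreserving (g 0) (hgm 0) (hf1.toLp f)),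
    Lp.coeFn_compMeasurePreserving (hf1.toLp f) (hgm h),
    Lp.coeFn_compMeasurePreserving (hf1.toLp f) (hgm 0), hf1.coeFn_toLp,
    (hgm h).quasiMeasurePreserving.ae hf1.coeFn_toLp] with x h2 h3 h4 h5 h6
  have h7 : g 0 x = x := add_zero x
  rw [h2, Pi.sub_apply, h3, h4, Function.comp_apply, Function.comp_apply, h6, h7, h5]
  rfl

/-- A bounded `a` need not be uniformly continuous, but against an integrable weight `(a(·+h) - a) g
= (a(·+h) g(·+h) - a g) - a(·+h) (g(·+h) - g)`, and both terms tend to `0` in `L¹`. -/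
theorem tendsto_integral_oscillation {a g : Rn n → ℝ} (ha : Measurable a) {A : ℝ}
    (ha0 : ∀ x, 0 ≤ a x) (haA : ∀ᵐ x, a x ≤ A) (hg : Integrable g) (hg0 : ∀ x, 0 ≤ g x) :
    Tendsto (fun h : Rn n => ∫ x, |a (x + h) - a x| * g x) (𝓝 0) (𝓝 0) := by
  have hag : Integrable fun x => a x * g x :=
    hg.bdd_mul (c := A) ha.aestronglyMeasurable (by
      filter_upwards [haA] with x hx
      rwa [norm_of_nonneg (ha0 x)])
  have h1 := (tendsto_integral_norm_comp_add_right_sub hag).add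
    ((tendsto_integral_norm_comp_add_right_sub hg).const_mul A)
  rw [mul_zero, add_zero] at h1
  refine squeeze_zero (fun h => integral_nonneg fun x => mul_nonneg (abs_nonneg _) (hg0 x))
    (fun h => ?_) h1
  have hag' : Integrable fun x => ‖a (x + h) * g (x + h) - a x * g x‖ :=
    (hag.comp_add_right h).sub hag |>.norm
  have hg' : Integrable fun x => A * ‖g (x + h) - g x‖ :=
    ((hg.comp_add_right h).sub hg |>.norm).const_mul A
  rw [← integral_const_mul, ← integral_add hag' hg']
  refine integral_mono_of_nonneg (ae_of_all _ fun x => mul_nonneg (abs_nonneg _) (hg0 x))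
    (hag'.add hg') ?_
  filter_upwards [(measurePreserving_add_right volume h).quasiMeasurePreserving.ae haA] with x hx
  have h2 : |a (x + h) - a x| * g x = |(a (x + h) * g (x + h) - a x * g x) -
      a (x + h) * (g (x + h) - g x)| := by
    rw [← abs_of_nonneg (hg0 x), ← abs_mul, abs_of_nonneg (hg0 x)]
    congr 1
    ring
  simp only [Real.norm_eq_abs, h2]
  refine (abs_sub _ _).trans ?_
  rw [abs_mul, abs_of_nonneg (ha0 (x + h))]
  gcongr

theorem ae_norm_sqrt_mul_sqrt_le {γ : Rn n → ℝ} {Γ : ℝ} (hΓ : ∀ᵐ x, γ x ≤ Γ) (h : Rn n) :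
    ∀ᵐ x, ‖((√(γ x) * √(γ (x + h)) : ℝ) : ℂ)‖ ≤ √Γ * √Γ := by
  filter_upwards [hΓ, (measurePreserving_add_right volume h).quasiMeasurePreserving.ae hΓ]
    with x h1 h2
  rw [Complex.norm_real, norm_of_nonneg (by positivity)]
  gcongr

theorem norm_incrementForm_le {γ : Rn n → ℝ} {Γ : ℝ} (hΓ : ∀ᵐ x, γ x ≤ Γ)
    {u φ : Rn n → ℂ} {G Φ : Rn n → Cn n} (hu : HasL2Expansion u G) (hφ : HasL2Expansion φ Φ) :
    ∃ K, ∀ h, ‖incrementForm γ u φ h‖ ≤ K * min 1 (‖h‖ ^ 2) := by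
  obtain ⟨K, hK, hb⟩ := hu.exists_eLpNorm_sub_le
  obtain ⟨L, hL, hb'⟩ := hφ.exists_eLpNorm_sub_le
  refine ⟨√Γ * √Γ * (K * L), fun h => ?_⟩
  refine (norm_integral_mul_mul_le (by positivity) (by positivity) (ae_norm_sqrt_mul_sqrt_le hΓ h)
    ((aestronglyMeasurable_comp_add_right hu.memLp.1 h).sub hu.memLp.1)
    ((aestronglyMeasurable_comp_add_right hφ.memLp.1 h).sub hφ.memLp.1) (hb h) (hb' h)
    (by positivity)).trans (le_of_eq ?_)
  rcases le_total 1 ‖h‖ with hh | hh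
  · rw [min_eq_left hh, min_eq_left (by nlinarith)]; ring
  · rw [min_eq_right hh, min_eq_right (by nlinarith [norm_nonneg h])]; ring

theorem sum_coord_mul_integral_eq {w : Rn n → ℂ} {B : ℝ} (hwm : AEStronglyMeasurable w volume)
    (hw : ∀ᵐ x, ‖w x‖ ≤ B) {G Φ : Rn n → Cn n} (hG : MemLp G 2 volume) (hΦ : MemLp Φ 2 volume)
    (h : Rn n) :
    ∑ i, ∑ j, ((h i * h j : ℝ) : ℂ) * ∫ x, w x * (G x i * Φ x j) =
      ∫ x, w x * ((∑ i, ((h i : ℝ) : ℂ) * G x i) * ∑ j, ((h j : ℝ) : ℂ) * Φ x j) := by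
  have hint : ∀ i j, Integrable fun x => ((h i * h j : ℝ) : ℂ) * (w x * (G x i * Φ x j)) :=
    fun i j => (integrable_mul_mul hwm hw (memLp_piLp_iff.1 hG i)
      (memLp_piLp_iff.1 hΦ j)).const_mul _
  simp only [← integral_const_mul]
  have h1 : ∀ i, ∑ j, ∫ x, ((h i * h j : ℝ) : ℂ) * (w x * (G x i * Φ x j)) =
      ∫ x, ∑ j, ((h i * h j : ℝ) : ℂ) * (w x * (G x i * Φ x j)) := fun i =>
    (integral_finsetSum _ fun j _ => hint i j).symm
  simp only [h1]
  rw [← integral_finsetSum _ fun i _ => integrable_finsetSum _ fun j _ => hint i j]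
  congr 1
  ext x
  rw [Finset.sum_mul_sum]
  simp only [Finset.mul_sum]
  refine Finset.sum_congr rfl fun i _ => Finset.sum_congr rfl fun j _ => ?_
  push_cast
  ring

theorem norm_integral_oscillation_le {γ : Rn n → ℝ} (hγ : Measurable γ) {Γ : ℝ}
    (hΓ : ∀ᵐ x, γ x ≤ Γ) {G Φ : Rn n → Cn n} (hG : MemLp G 2 volume) (hΦ : MemLp Φ 2 volume)
    (h : Rn n) :
    ‖∫ x, (((√(γ x) * √(γ (x + h)) : ℝ) : ℂ) - ((√(γ x) * √(γ x) : ℝ) : ℂ)) *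
      ((∑ i, ((h i : ℝ) : ℂ) * G x i) * ∑ j, ((h j : ℝ) : ℂ) * Φ x j)‖ ≤
    √Γ * n ^ 2 * ‖h‖ ^ 2 * ∫ x, |√(γ (x + h)) - √(γ x)| * (‖G x‖ * ‖Φ x‖) := by
  rw [← integral_const_mul]
  have hsh := (measurePreserving_add_right volume h).quasiMeasurePreserving.ae hΓ
  have hgi : Integrable fun x => ‖G x‖ * ‖Φ x‖ := hG.norm.integrable_mul hΦ.norm
  have hm : Measurable fun x => |√(γ (x + h)) - √(γ x)| := by fun_prop
  have hosc : Integrable fun x => |√(γ (x + h)) - √(γ x)| * (‖G x‖ * ‖Φ x‖) := by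
    refine hgi.bdd_mul (c := √Γ + √Γ) hm.aestronglyMeasurable ?_
    filter_upwards [hΓ, hsh] with x h1 h2
    rw [norm_eq_abs, abs_abs]
    refine (abs_sub _ _).trans ?_
    rw [abs_of_nonneg (sqrt_nonneg _), abs_of_nonneg (sqrt_nonneg _)]
    gcongr
  refine norm_integral_le_of_norm_le (hosc.const_mul _) ?_
  filter_upwards [hΓ] with x hx
  have h1 : ‖((√(γ x) * √(γ (x + h)) : ℝ) : ℂ) - ((√(γ x) * √(γ x) : ℝ) : ℂ)‖ ≤
      √Γ * |√(γ (x + h)) - √(γ x)| := by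
    rw [← Complex.ofReal_sub, ← mul_sub, Complex.norm_real, norm_mul, norm_of_nonneg (sqrt_nonneg _)]
    exact mul_le_mul_of_nonneg_right (sqrt_le_sqrt hx) (norm_nonneg _)
  rw [norm_mul, norm_mul]
  calc _ ≤ (√Γ * |√(γ (x + h)) - √(γ x)|) * ((n * ‖h‖ * ‖G x‖) * (n * ‖h‖ * ‖Φ x‖)) := by
        gcongr
        · exact norm_sum_coord_mul_le h (G x)
        · exact norm_sum_coord_mul_le h (Φ x)
    _ = _ := by ring

theorem memLp_sum_coord_mul {G : Rn n → Cn n} (hG : MemLp G 2 volume) (h : Rn n) :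
    MemLp (fun x => ∑ i, ((h i : ℝ) : ℂ) * G x i) 2 volume :=
  memLp_finsetSum _ fun i _ => (memLp_piLp_iff.1 hG i).const_mul _

theorem eLpNorm_sum_coord_mul_le {G : Rn n → Cn n} (hG : MemLp G 2 volume) (h : Rn n) :
    eLpNorm (fun x => ∑ i, ((h i : ℝ) : ℂ) * G x i) 2 volume ≤
      ENNReal.ofReal (n * ‖h‖ * (eLpNorm G 2 volume).toReal) := by
  rw [ENNReal.ofReal_mul (by positivity), ENNReal.ofReal_toReal hG.2.ne]
  exact eLpNorm_le_mul_eLpNorm_of_ae_le_mul (ae_of_all _ fun x => norm_sum_coord_mul_le h (G x)) 2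

/-- With `w_h = γ^{1/2} γ(·+h)^{1/2}` and `δ` the increment by `h`, the error splits as `w_h (δu -
h·G) δφ + w_h (h·G)(δφ - h·Φ) + (w_h - w_0)(h·G)(h·Φ)`. The first two integrals are `O(|h|³)`, and
the third is `|h|²` times an oscillation integral tending to `0`. -/
theorem incrementForm_expansion {γ : Rn n → ℝ} (hγ : Measurable γ) {Γ : ℝ}
    (hΓ : ∀ᵐ x, γ x ≤ Γ)
    {u φ : Rn n → ℂ} {G Φ : Rn n → Cn n} (hu : HasL2Expansion u G) (hφ : HasL2Expansion φ Φ)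
    {ε : ℝ} (hε : 0 < ε) : ∃ δ > 0, ∀ h : Rn n, ‖h‖ < δ →
      ‖incrementForm γ u φ h - ∑ i, ∑ j, ((h i * h j : ℝ) : ℂ) *
        ∫ x, ((√(γ x) * √(γ x) : ℝ) : ℂ) * (G x i * Φ x j)‖ ≤ ε * ‖h‖ ^ 2 := by
  obtain ⟨C, hC, hCu⟩ := hu.bound
  obtain ⟨D, hD, hDφ⟩ := hφ.bound
  obtain ⟨L, hL, hLφ⟩ := hφ.exists_eLpNorm_sub_le
  set b := (eLpNorm G 2 volume).toReal
  have hb : 0 ≤ b := ENNReal.toReal_nonneg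
  have hg : Integrable fun x => ‖G x‖ * ‖Φ x‖ :=
    hu.memLp_grad.norm.integrable_mul hφ.memLp_grad.norm
  have hosc := tendsto_integral_oscillation (a := fun x => √(γ x)) (A := √Γ) (by fun_prop)
    (fun x => sqrt_nonneg _) (hΓ.mono fun x hx => sqrt_le_sqrt hx) hg fun x => by positivity
  -- This is the total error bound divided by `|h|²`; `δ` comes from its convergence to `0`.
  have hlim : Tendsto (fun h : Rn n => √Γ * √Γ * (C * L + n * b * D) * ‖h‖ +
      √Γ * n ^ 2 * ∫ x, |√(γ (x + h)) - √(γ x)| * (‖G x‖ * ‖Φ x‖)) (𝓝 0) (𝓝 0) := by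
    have h1 := ((tendsto_norm_zero (E := Rn n)).const_mul
      (√Γ * √Γ * (C * L + n * b * D))).add (hosc.const_mul (√Γ * n ^ 2))
    simpa using h1
  obtain ⟨δ, hδ, hball⟩ := Metric.eventually_nhds_iff.1 (hlim.eventually_lt_const hε)
  refine ⟨δ, hδ, fun h hh => ?_⟩
  have hbound := (hball (y := h) (by rwa [dist_zero_right])).le
  have hm1 : AEStronglyMeasurable (fun x => ((√(γ x) * √(γ (x + h)) : ℝ) : ℂ)) volume :=
    Measurable.aestronglyMeasurable (by fun_prop)
  have hm0 : AEStronglyMeasurable (fun x => ((√(γ x) * √(γ x) : ℝ) : ℂ)) volume :=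
    Measurable.aestronglyMeasurable (by fun_prop)
  have hw1 := ae_norm_sqrt_mul_sqrt_le hΓ h
  have hw0 : ∀ᵐ x, ‖((√(γ x) * √(γ x) : ℝ) : ℂ)‖ ≤ √Γ * √Γ := by
    simpa using ae_norm_sqrt_mul_sqrt_le hΓ 0
  rw [sum_coord_mul_integral_eq hm0 hw0 hu.memLp_grad hφ.memLp_grad]
  have hdu : MemLp (fun x => u (x + h) - u x) 2 volume :=
    (hu.memLp.comp_measurePreserving (measurePreserving_add_right volume h)).sub hu.memLp
  have hdφ : MemLp (fun x => φ (x + h) - φ x) 2 volume :=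
    (hφ.memLp.comp_measurePreserving (measurePreserving_add_right volume h)).sub hφ.memLp
  have hGu := memLp_sum_coord_mul hu.memLp_grad h
  have hGφ := memLp_sum_coord_mul hφ.memLp_grad h
  have i1 : Integrable fun x => ((√(γ x) * √(γ (x + h)) : ℝ) : ℂ) *
      ((u (x + h) - u x - ∑ i, ((h i : ℝ) : ℂ) * G x i) * (φ (x + h) - φ x)) :=
    integrable_mul_mul hm1 hw1 (hdu.sub hGu) hdφ
  have i2 : Integrable fun x => ((√(γ x) * √(γ (x + h)) : ℝ) : ℂ) *
      ((∑ i, ((h i : ℝ) : ℂ) * G x i) * (φ (x + h) - φ x - ∑ i, ((h i : ℝ) : ℂ) * Φ x i)) :=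
    integrable_mul_mul hm1 hw1 hGu (hdφ.sub hGφ)
  have i3 : Integrable fun x =>
      (((√(γ x) * √(γ (x + h)) : ℝ) : ℂ) - ((√(γ x) * √(γ x) : ℝ) : ℂ)) *
      ((∑ i, ((h i : ℝ) : ℂ) * G x i) * ∑ i, ((h i : ℝ) : ℂ) * Φ x i) := by
    simp only [sub_mul]
    exact (integrable_mul_mul hm1 hw1 hGu hGφ).sub (integrable_mul_mul hm0 hw0 hGu hGφ)
  have n1 := norm_integral_mul_mul_le (by positivity) (by positivity) hw1 (hdu.sub hGu).1 hdφ.1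
    (hCu h) (hLφ h) (by positivity)
  have n2 := norm_integral_mul_mul_le (by positivity) (by positivity) hw1 hGu.1 (hdφ.sub hGφ).1
    (eLpNorm_sum_coord_mul_le hu.memLp_grad h) (hDφ h) (by positivity)
  have n3 := norm_integral_oscillation_le hγ hΓ hu.memLp_grad hφ.memLp_grad h
  have i12 := i1.add i2
  have key := (integral_sub (integrable_mul_mul hm1 hw1 hdu hdφ)
    (integrable_mul_mul hm0 hw0 hGu hGφ)).symm.trans ((integral_congr_ae (ae_of_all _ fun x => by
      simp only [Pi.add_apply]; ring)).trans (integral_add i12 i3))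
  rw [integral_add' i1 i2] at key
  rw [incrementForm, key]
  have hmin : L * min 1 ‖h‖ ≤ L * ‖h‖ := mul_le_mul_of_nonneg_left (min_le_right _ _) hL
  calc _ ≤ √Γ * √Γ * (C * ‖h‖ ^ 2 * (L * min 1 ‖h‖)) +
        √Γ * √Γ * (n * ‖h‖ * b * (D * ‖h‖ ^ 2)) +
        √Γ * n ^ 2 * ‖h‖ ^ 2 * ∫ x, |√(γ (x + h)) - √(γ x)| * (‖G x‖ * ‖Φ x‖) :=
      (norm_add_le _ _).trans (add_le_add ((norm_add_le _ _).trans (add_le_add n1 n2)) n3)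
    _ ≤ √Γ * √Γ * (C * ‖h‖ ^ 2 * (L * ‖h‖)) +
        √Γ * √Γ * (n * ‖h‖ * b * (D * ‖h‖ ^ 2)) +
        √Γ * n ^ 2 * ‖h‖ ^ 2 * ∫ x, |√(γ (x + h)) - √(γ x)| * (‖G x‖ * ‖Φ x‖) := by gcongr
    _ = (√Γ * √Γ * (C * L + n * b * D) * ‖h‖ +
        √Γ * n ^ 2 * ∫ x, |√(γ (x + h)) - √(γ x)| * (‖G x‖ * ‖Φ x‖)) * ‖h‖ ^ 2 := by ring
    _ ≤ ε * ‖h‖ ^ 2 := mul_le_mul_of_nonneg_right hbound (by positivity)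

end Limit

end

end FracCond

/-! ### The limit `s → 1` -/

theorem lemma4p2 (n : ℕ) (Ω : TopologicalSpace.Opens (FracCond.Rn n))
    -- the exponent `p = n / (2 s₀)` lies in `(1, ∞)`
    (s₀ : ℝ) (hs₀ : s₀ ∈ Set.Ioo (0 : ℝ) 1) (hn : 2 * s₀ < n)
    (p : ℝ≥0∞) [Fact (1 ≤ p)] (hp : p = ENNReal.ofReal ((n : ℝ) / (2 * s₀)))
    (γ : FracCond.Rn n → ℝ) (hγ : Measurable γ)
    (γlow γup : ℝ) (hlow : 0 < γlow) (hbd : ∀ᵐ x, γlow ≤ γ x ∧ γ x ≤ γup)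
    (hm : FracCond.MemWc Ω 2 p (fun x => ((Real.sqrt (γ x) - 1 : ℝ) : ℂ)))
    (u : FracCond.Rn n → ℂ) (hu : FracCond.MemW 2 2 u) :
    -- for every `s`, the operator is well defined as a pairing of `L²(ℝ²ⁿ)` functions
    (∀ s ∈ Set.Ioo (0 : ℝ) 1,
      MemLp (FracCond.fracFlux s γ u) 2 volume ∧
      ∀ φ : 𝓓((⊤ : TopologicalSpace.Opens (FracCond.Rn n)), ℂ),
        MemLp (FracCond.fracGrad s φ) 2 volume) ∧
    -- `C^s_γ u → -∇·(γ∇u)` in the sense of distributions, with `G = ∇u`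
    ∃ G : FracCond.Rn n → FracCond.Cn n,
      MemLp G 2 volume ∧ FracCond.IsWeakGradient u G ∧
      ∀ φ : 𝓓((⊤ : TopologicalSpace.Opens (FracCond.Rn n)), ℂ),
        Tendsto (fun s : ℝ => FracCond.fracCond s γ u φ) (𝓝[<] 1)
          (𝓝 (-FracCond.distDiv (fun x => ((γ x : ℝ) : ℂ) • G x) φ)) := by
  have hn0 : n ≠ 0 := by
    rintro rfl
    have := hs₀.1
    norm_num at hn
    linarith
  have hΓ : ∀ᵐ x, γ x ≤ γup := hbd.mono fun x hx => hx.2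
  obtain ⟨G, hG, hw⟩ := FracCond.exists_hasL2Expansion hu
  have hgrad : ∀ s ∈ Set.Ioo (0 : ℝ) 1,
      ∀ φ : 𝓓((⊤ : TopologicalSpace.Opens (FracCond.Rn n)), ℂ),
        MemLp (FracCond.fracGrad s φ) 2 volume := fun s hs φ =>
    FracCond.memLp_fracGrad hn0 hs (FracCond.hasL2Expansion_testFunction φ)
  have hflux : ∀ s ∈ Set.Ioo (0 : ℝ) 1, MemLp (FracCond.fracFlux s γ u) 2 volume := fun s hs =>
    FracCond.memLp_fracFlux hγ hΓ (FracCond.memLp_fracGrad hn0 hs hG)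
  refine ⟨fun s hs => ⟨hflux s hs, hgrad s hs⟩, G, hG.memLp_grad, hw, fun φ => ?_⟩
  have hφ := FracCond.hasL2Expansion_testFunction φ
  obtain ⟨K, hK⟩ := FracCond.norm_incrementForm_le (γ := γ) hΓ hG hφ
  -- Unification with the expansion fixes the matrix as `A_ij = ∫ γ^{1/2} γ^{1/2} G_i ∂_jφ`.
  have hlim := FracCond.tendsto_integral_fracKernel_mul hn0
    (FracCond.aestronglyMeasurable_incrementForm hγ hG.memLp.1 hφ.memLp.1) hK _
    fun ε hε => FracCond.incrementForm_expansion hγ hΓ hG hφ hε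
  -- The trace of that matrix is the weak form of `-∇·(γ∇u)`; `√γ √γ = γ` needs `γ ≥ 0`, known
  -- almost everywhere.
  have hval : -FracCond.distDiv (fun x => ((γ x : ℝ) : ℂ) • G x) φ =
      ∑ i, ∫ x, ((√(γ x) * √(γ x) : ℝ) : ℂ) * (G x i * FracCond.partialDeriv i φ x) := by
    rw [FracCond.distDiv, neg_neg, ← integral_finsetSum]
    · refine integral_congr_ae ?_
      filter_upwards [hbd] with x hx
      rw [Real.mul_self_sqrt (hlow.le.trans hx.1)]
      simp [mul_assoc]
    · intro i _
      refine FracCond.integrable_mul_mul (B := √γup * √γup)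
        (Measurable.aestronglyMeasurable (by fun_prop)) ?_ (memLp_piLp_iff.1 hG.memLp_grad i)
        (memLp_piLp_iff.1 hφ.memLp_grad i)
      filter_upwards [hΓ] with x hx
      rw [Complex.norm_real, Real.norm_of_nonneg (by positivity)]
      gcongr
  rw [hval]
  have h1 : ∀ᶠ s : ℝ in 𝓝[<] 1, s ∈ Set.Ioo (0 : ℝ) 1 := Ioo_mem_nhdsLT one_pos
  exact hlim.congr' (h1.mono fun s hs =>
    (FracCond.fracCond_eq_integral hs.1 (hflux s hs) (hgrad s hs φ)).symm)
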